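/- Let $b\ge 2$ be an integer. Let $(\epsilon(w))_{w}$, indexed by the finite words $w$ over the alphabet $\{0,\dots,b-1\}$, be independent random variables on a probability space, each equal to $1$ with probability $\frac{1+b^{-1/2}}{2}$ and to $-1$ with probability $\frac{1-b^{-1/2}}{2}$. For $n\ge 1$ and $t\in[0,1]$ put $$B^{1/2}_n(t)=b^{-n/2}\int_0^t b^n\,\epsilon(u|1)\,\epsilon(u|2)\cdots\epsilon(u|n)\,du ,$$ where $u|j$ is the word formed by the first $j$ digits of $u$ in base $b$ (defined unambiguously for all $u\in[0,1]$ that are not $b$-adic); thus $B^{1/2}_n$ is the continuous function on $[0,1]$ that vanishes at $0$, is linear on each $b$-adic interval of generation $n$, and has increment $b^{-n/2}\prod_{j=1}^n\epsilon(w_1\cdots w_j)$ on the interval $\big[\sum_{k=1}^n w_kb^{-k},\ \sum_{k=1}^n w_kb^{-k}+b^{-n}\big]$ for every word $w=w_1\cdots w_n$. Let $\sigma_{1/2}=\sqrt{(b-1)/b}$. Then, as $n\to\infty$, the laws of the random functions $B^{1/2}_n/(\sigma_{1/2}\sqrt n)$ converge weakly on $\mathcal C([0,1])$ (with the uniform topology)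 to the Wiener measure, that is, to the law on $\mathcal C([0,1])$ of standard Brownian motion. -/

import Mathlib

open MeasureTheory ProbabilityTheory Filter
open scoped unitInterval Topology

noncomputable section

/-- `C([0,1])`, with its topology of uniform convergence, carries its Borel σ-algebra. -/
instance instMeasurableSpaceCI : MeasurableSpace C(I, ℝ) := borel C(I, ℝ)

instance instBorelSpaceCI : BorelSpace C(I, ℝ) := ⟨rfl⟩

/-- `W` is the Wiener measure on `C([0,1])`: under `W` the coordinate process is a standard
Brownian motion, that is, it starts at `0`, has independent increments, and its increment over
`[s, t]` has law `N(0, t - s)`. -/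
structure IsWienerMeasure (W : Measure C(I, ℝ)) : Prop where
  start_zero : ∀ᵐ f ∂W, f 0 = 0
  indep_increments : HasIndepIncrements (fun (t : I) (f : C(I, ℝ)) => f t) W
  gaussian_increments : ∀ s t : I, s ≤ t →
    HasLaw (fun f : C(I, ℝ) => f t - f s) (gaussianReal 0 (Real.toNNReal ((t : ℝ) - s))) W

/-- The law on `{-1, 1}` that gives mass `(1 + b ^ (H - 1)) / 2` to `1` and the remaining mass
`(1 - b ^ (H - 1)) / 2` to `-1`. -/
def signLaw (b : ℕ) (H : ℝ) : Measure ℝ :=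
  ENNReal.ofReal ((1 + (b : ℝ) ^ (H - 1)) / 2) • Measure.dirac 1 +
    ENNReal.ofReal (1 - (1 + (b : ℝ) ^ (H - 1)) / 2) • Measure.dirac (-1)

/-- The word made of the first `n` digits of `u ∈ [0,1)` in base `b`. (The choice of the expansion
matters only at the `b`-adic points, a null set.) -/
def digitWord (b : ℕ) [NeZero b] (u : ℝ) (n : ℕ) : List (Fin b) :=
  List.ofFn fun i : Fin n => Real.digits u b i

/-- The product `ε(u|1) ε(u|2) ⋯ ε(u|n)` of the weights of the prefixes of the expansion of `u`. -/
def prefixProd {b : ℕ} [NeZero b] (ε : List (Fin b) → ℝ) (n : ℕ) (u : ℝ) : ℝ :=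
  ∏ j ∈ Finset.Icc 1 n, ε (digitWord b u j)

theorem measurable_comp_digitWord {b : ℕ} [NeZero b] (ε : List (Fin b) → ℝ) (n : ℕ) :
    Measurable fun u : ℝ => ε (digitWord b u n) := by
  have h : Measurable fun (u : ℝ) (i : Fin n) => Real.digits u b i := by
    refine measurable_pi_lambda _ fun i => ?_
    have h1 : Measurable fun u : ℝ => ⌊u * (b : ℝ) ^ ((i : ℕ) + 1)⌋₊ :=
      Nat.measurable_floor.comp (measurable_id.mul_const _)
    exact (measurable_of_countable (Fin.ofNat b)).comp h1
  exact (measurable_of_countable fun w : Fin n → Fin b => ε (List.ofFn w)).comp h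

theorem exists_abs_comp_digitWord_le {b : ℕ} [NeZero b] (ε : List (Fin b) → ℝ) (n : ℕ) :
    ∃ C : ℝ, ∀ u : ℝ, |ε (digitWord b u n)| ≤ C := by
  obtain ⟨C, hC⟩ := (Set.finite_range fun w : Fin n → Fin b => |ε (List.ofFn w)|).bddAbove
  exact ⟨C, fun u => hC ⟨_, rfl⟩⟩

theorem intervalIntegrable_prefixProd {b : ℕ} [NeZero b] (ε : List (Fin b) → ℝ) (n : ℕ)
    (x y : ℝ) : IntervalIntegrable (fun u => (b : ℝ) ^ n * prefixProd ε n u) volume x y := by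
  refine IntervalIntegrable.const_mul ?_ _
  choose C hC using exists_abs_comp_digitWord_le ε
  refine (intervalIntegrable_const (c := ∏ j ∈ Finset.Icc 1 n, C j)).mono_fun ?_ ?_
  · exact (Finset.measurable_prod _ fun j _ => measurable_comp_digitWord ε j).aestronglyMeasurable
  · refine Eventually.of_forall fun u => ?_
    simp only [prefixProd, Real.norm_eq_abs]
    rw [Finset.abs_prod]
    exact (Finset.prod_le_prod (fun _ _ => abs_nonneg _) fun j _ => hC j u).trans (le_abs_self _)

/-- The continuous path `B_n` built from the weights `ε`:
`B_n(t) = b ^ (-n H) ∫₀ᵗ b ^ n ε(u|1) ⋯ ε(u|n) du`. It is piecewise linear, vanishes at `0`, and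
its increment over the `b`-adic interval of the word `w` of length `n` is
`b ^ (-n H) ε(w|1) ⋯ ε(w|n)`. -/
def cascadePath (b : ℕ) [NeZero b] (H : ℝ) (ε : List (Fin b) → ℝ) (n : ℕ) : C(I, ℝ) where
  toFun t := (b : ℝ) ^ (-((n : ℝ) * H)) *
    ∫ u in (0 : ℝ)..(t : ℝ), (b : ℝ) ^ n * prefixProd ε n u
  continuous_toFun := continuous_const.mul
    ((intervalIntegral.continuous_primitive (intervalIntegrable_prefixProd ε n) 0).comp
      continuous_subtype_val)

/-- The constant `σ_{1/2}`. -/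
def sigmaHalf (b : ℕ) : ℝ := Real.sqrt (((b : ℝ) - 1) / b)

end

/-!
The path `B_n` is polygonal on the `b`-adic grid of generation `n`, with increments
`b ^ (-n / 2) Q_n(w)`, where `Q_n(w)` is the product of the weights along the branch of the `b`-ary
tree that leads to `w` (`cascadePath_eq_polyline`). At the exponent `1 / 2` the mean of a weight is
`b ^ (-1 / 2)`, and the increments over the intervals of a fixed generation `m` then gain in each
further generation a fluctuation of the same order, asymptotically Gaussian and independent of the
past; this is why the normalisation is `√n`.

*Finite-dimensional distributions.* Conditionally on the first `n` generations, a linear form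
`∑ s_k Q_{n+1}(k)` is a sum of independent signs with means `± b ^ (-1 / 2)`. Replacing them by
Gaussian variables costs `O(∑ |s_k| ^ 3)` in the characteristic function, and leaves the factor
`exp (-(1 - 1 / b) ∑ s_k ^ 2 / 2)` times the characteristic function of the linear form of
generation `n` whose coefficients are `b ^ (-1 / 2)` times the block sums of `s`
(`IsSignCascade.norm_charFun_nodeForm_succ_sub_le`). For the forms that express increments over the
intervals of generation `m` (`levelCoeff`), the sum `∑ s_k ^ 2` is the same in all generations, so
that after division by `σ √n` the `n - m` Gaussian factors multiply to a convergent exponential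
while the errors are `O(n * n ^ (-3 / 2))` (`IsSignCascade.tendsto_charFun_cascadeIncr`).

*Tightness.* The same recursion with Hoeffding's inequality in place of the expansion bounds the
exponential moments, hence gives fourth moments of order `b ^ (-2 m)` for the normalised increments
over the intervals of generation `m`, uniformly in `n`
(`IsSignCascade.integral_cascadeIncr_pow_four_le`). Chaining over the generations bounds the
expected uniform distance between a path and its interpolation on the grid of generation `m` by
`O(b ^ (-m / 4))` (`IsSignCascade.integral_norm_sub_polyline_le`). So for a bounded Lipschitz `F`
the expectation of `F` at the `n`-th path may be computed, up to an error uniform in `n`, from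
finitely many increments, and those converge in law to the increments of Brownian motion
(`IsSignCascade.tendstoInDistribution`). No compactness criterion in `C([0,1])` is needed.

*Wiener measure.* Its existence is proved along the same lines: the isonormal Gaussian process on
`L²(ℝ)` evaluated at the indicators of `(0, t]` is a Brownian motion up to the continuity of its
paths (`exists_isPreBrownianReal`), and the chaining estimate makes its dyadic interpolations
converge uniformly almost surely
(`ProbabilityTheory.IsPreBrownianReal.exists_continuous_modification`).
-/

noncomputable section

/-! ### Polygonal paths -/

/-- The sum of `d` over the `w`-th block of `q` consecutive integers. -/
def blockSum (q : ℕ) (d : ℕ → ℝ) (w : ℕ) : ℝ := ∑ l ∈ Finset.range q, d (w * q + l)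

theorem sum_range_mul_eq_sum_blocks {M : Type*} [AddCommMonoid M] (N q : ℕ) (f : ℕ → M) :
    ∑ k ∈ Finset.range (N * q), f k
      = ∑ w ∈ Finset.range N, ∑ l ∈ Finset.range q, f (w * q + l) := by
  induction N with
  | zero => simp
  | succ N ih => rw [Nat.succ_mul, Finset.sum_range_add, ih, Finset.sum_range_succ]

theorem sum_range_mul_comp_div {M : Type*} [AddCommMonoid M] (N : ℕ) {q : ℕ} (hq : 0 < q)
    (f : ℕ → M) :
    ∑ k ∈ Finset.range (N * q), f (k / q) = q • ∑ w ∈ Finset.range N, f w := by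
  rw [sum_range_mul_eq_sum_blocks, Finset.smul_sum]
  refine Finset.sum_congr rfl fun w _ => ?_
  rw [Finset.sum_congr rfl (g := fun _ => f w), Finset.sum_const, Finset.card_range]
  intro l hl
  rw [mul_comm, Nat.mul_add_div hq, Nat.div_eq_of_lt (Finset.mem_range.1 hl), add_zero]

theorem blockSum_mul (b q : ℕ) (d : ℕ → ℝ) (w : ℕ) :
    blockSum (b * q) d w = blockSum b (blockSum q d) w := by
  simp only [blockSum]
  rw [sum_range_mul_eq_sum_blocks]
  refine Finset.sum_congr rfl fun i _ => Finset.sum_congr rfl fun l _ => ?_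
  congr 1
  ring

theorem blockSum_one (d : ℕ → ℝ) (w : ℕ) : blockSum 1 d w = d w := by simp [blockSum]

/-- The function that climbs linearly from `0` to `1` on the `k`-th of the `N` intervals of length
`1 / N`, and is constant elsewhere. -/
def ramp (N k : ℕ) : C(I, ℝ) where
  toFun t := max 0 (min 1 (N * (t : ℝ) - k))
  continuous_toFun := by fun_prop

theorem ramp_apply (N k : ℕ) (t : I) : ramp N k t = max 0 (min 1 (N * (t : ℝ) - k)) := rfl

theorem ramp_eq_zero {N k : ℕ} {t : I} (h : N * (t : ℝ) ≤ k) : ramp N k t = 0 := by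
  rw [ramp_apply, max_eq_left]
  exact (min_le_right _ _).trans (by linarith)

theorem ramp_eq_one {N k : ℕ} {t : I} (h : (k : ℝ) + 1 ≤ N * (t : ℝ)) : ramp N k t = 1 := by
  rw [ramp_apply, min_eq_left (by linarith), max_eq_right zero_le_one]

theorem ramp_eq_sub {N k : ℕ} {t : I} (h : (k : ℝ) ≤ N * (t : ℝ)) (h' : N * (t : ℝ) ≤ k + 1) :
    ramp N k t = N * (t : ℝ) - k := by
  rw [ramp_apply, min_eq_right (by linarith), max_eq_right (by linarith)]

theorem ramp_mem_Icc (N k : ℕ) (t : I) : ramp N k t ∈ Set.Icc (0 : ℝ) 1 :=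
  ⟨le_max_left _ _, max_le zero_le_one (min_le_left _ _)⟩

/-- The polygonal path that vanishes at `0` and has increment `d k` on `[k / N, (k + 1) / N]`. -/
def polyline (N : ℕ) (d : ℕ → ℝ) : C(I, ℝ) := ∑ k ∈ Finset.range N, d k • ramp N k

theorem polyline_apply (N : ℕ) (d : ℕ → ℝ) (t : I) :
    polyline N d t = ∑ k ∈ Finset.range N, d k * ramp N k t := by
  simp [polyline, ContinuousMap.sum_apply]

/-- Every point of `[0,1]` lies in one of the `N` closed intervals of length `1 / N`. -/
theorem exists_cell {N : ℕ} (hN : 0 < N) (t : I) :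
    ∃ k < N, (k : ℝ) ≤ N * (t : ℝ) ∧ N * (t : ℝ) ≤ k + 1 := by
  have hN' : (0 : ℝ) < N := by exact_mod_cast hN
  have h0 : 0 ≤ N * (t : ℝ) := mul_nonneg hN'.le t.2.1
  rcases eq_or_lt_of_le t.2.2 with h | h
  · refine ⟨N - 1, by omega, ?_, ?_⟩
    · rw [h, mul_one]; exact_mod_cast Nat.sub_le _ _
    · rw [h, mul_one, Nat.cast_sub (by omega)]; simp
  · refine ⟨⌊N * (t : ℝ)⌋₊, ?_, Nat.floor_le h0, (Nat.lt_floor_add_one _).le⟩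
    rw [Nat.floor_lt h0]
    nlinarith

theorem polyline_apply_of_mem_cell {N k : ℕ} (d : ℕ → ℝ) {t : I} (hk : k < N)
    (h : (k : ℝ) ≤ N * (t : ℝ)) (h' : N * (t : ℝ) ≤ k + 1) :
    polyline N d t = ∑ i ∈ Finset.range k, d i + (N * (t : ℝ) - k) * d k := by
  rw [polyline_apply, ← Finset.sum_range_add_sum_Ico _ hk.le, Finset.sum_eq_sum_Ico_succ_bot hk,
    ramp_eq_sub h h', Finset.sum_eq_zero (s := Finset.Ico (k + 1) N), add_zero, mul_comm (d k)]
  · congr 1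
    refine Finset.sum_congr rfl fun i hi => ?_
    rw [ramp_eq_one, mul_one]
    have : (i : ℝ) + 1 ≤ k := by exact_mod_cast Finset.mem_range.1 hi
    linarith
  · intro i hi
    rw [ramp_eq_zero, mul_zero]
    have : (k : ℝ) + 1 ≤ i := by exact_mod_cast (Finset.mem_Ico.1 hi).1
    linarith

/-- Passing from the grid of mesh `1 / (N * b)` to the coarser one of mesh `1 / N` moves a
polygonal path by at most `b` times the size of its increments. -/
theorem norm_polyline_sub_polyline_blockSum_le {N b : ℕ} (hN : 0 < N) {d : ℕ → ℝ} {M : ℝ}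
    (hM0 : 0 ≤ M) (hM : ∀ k < N * b, |d k| ≤ M) :
    ‖polyline (N * b) d - polyline N (blockSum b d)‖ ≤ b * M := by
  rw [ContinuousMap.norm_le _ (by positivity)]
  intro t
  obtain ⟨k₀, hk₀, h1, h2⟩ := exists_cell hN t
  rw [ContinuousMap.sub_apply, polyline_apply, polyline_apply, sum_range_mul_eq_sum_blocks,
    ← Finset.sum_sub_distrib]
  have hb0 : (0 : ℝ) ≤ b := Nat.cast_nonneg b
  have hterm : ∀ k ∈ Finset.range N, k ≠ k₀ →
      (∑ l ∈ Finset.range b, d (k * b + l) * ramp (N * b) (k * b + l) t)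
        - blockSum b d k * ramp N k t = 0 := by
    intro k _ hne
    rw [blockSum, Finset.sum_mul, ← Finset.sum_sub_distrib]
    refine Finset.sum_eq_zero fun l hl => ?_
    have hl' : (l : ℝ) + 1 ≤ b := by exact_mod_cast Finset.mem_range.1 hl
    have hl0 : (0 : ℝ) ≤ l := Nat.cast_nonneg l
    rcases lt_or_gt_of_ne hne with hlt | hlt
    · have h3 : (k : ℝ) + 1 ≤ k₀ := by exact_mod_cast hlt
      rw [ramp_eq_one, ramp_eq_one, sub_self]
      · linarith
      · push_cast
        nlinarith
    · have h3 : (k₀ : ℝ) + 1 ≤ k := by exact_mod_cast hlt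
      rw [ramp_eq_zero, ramp_eq_zero, mul_zero, sub_self]
      · linarith
      · push_cast
        nlinarith
  rw [Finset.sum_eq_single k₀ (fun k hk hne => hterm k hk hne)
    (fun h => absurd (Finset.mem_range.2 hk₀) h)]
  rw [blockSum, Finset.sum_mul, ← Finset.sum_sub_distrib]
  refine (norm_sum_le _ _).trans ?_
  have : (b : ℝ) * M = ∑ _l ∈ Finset.range b, M := by simp
  rw [this]
  refine Finset.sum_le_sum fun l hl => ?_
  rw [← mul_sub, norm_mul, Real.norm_eq_abs, Real.norm_eq_abs]
  have hidx : k₀ * b + l < N * b := by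
    have := Finset.mem_range.1 hl
    nlinarith
  have h3 : |ramp (N * b) (k₀ * b + l) t - ramp N k₀ t| ≤ 1 := by
    have ha := ramp_mem_Icc (N * b) (k₀ * b + l) t
    have hb := ramp_mem_Icc N k₀ t
    exact abs_sub_le_iff.2 ⟨by linarith [ha.2, hb.1], by linarith [hb.2, ha.1]⟩
  calc _ ≤ M * 1 := mul_le_mul (hM _ hidx) h3 (abs_nonneg _) hM0
    _ = M := mul_one M

/-- The point `k / N` of `[0,1]`, and `1` for larger `k` (unless `N = 0`). -/
def gridPoint (N k : ℕ) : I := Set.projIcc 0 1 zero_le_one ((k : ℝ) / N)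

theorem coe_gridPoint {N k : ℕ} (hk : k ≤ N) : (gridPoint N k : ℝ) = k / N := by
  rw [gridPoint, Set.projIcc_of_mem]
  exact ⟨by positivity, div_le_one_of_le₀ (by exact_mod_cast hk) (by positivity)⟩

theorem gridPoint_mono (N : ℕ) : Monotone (gridPoint N) := fun i j h =>
  Set.monotone_projIcc _ (by gcongr)

theorem gridPoint_zero (N : ℕ) : gridPoint N 0 = 0 :=
  Subtype.ext (by rw [coe_gridPoint (Nat.zero_le _)]; simp)

theorem polyline_increments_apply {N k : ℕ} (g : ℕ → ℝ) {t : I} (hk : k < N)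
    (h : (k : ℝ) ≤ N * (t : ℝ)) (h' : N * (t : ℝ) ≤ k + 1) :
    polyline N (fun i => g (i + 1) - g i) t
      = (1 - (N * (t : ℝ) - k)) * g k + (N * (t : ℝ) - k) * g (k + 1) - g 0 := by
  rw [polyline_apply_of_mem_cell _ hk h h', Finset.sum_range_sub]
  ring

theorem dist_gridPoint_le {N k : ℕ} {t : I} (hk : k < N)
    (h : (k : ℝ) ≤ N * (t : ℝ)) (h' : N * (t : ℝ) ≤ k + 1) :
    dist (gridPoint N k) t ≤ 1 / N ∧ dist (gridPoint N (k + 1)) t ≤ 1 / N := by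
  have hN' : (0 : ℝ) < N := by exact_mod_cast (Nat.zero_le k).trans_lt hk
  have e : N * (t : ℝ) / N = t := by field_simp
  have h1 : (k : ℝ) / N ≤ t := by rw [← e]; gcongr
  have h2 : (t : ℝ) ≤ (k + 1) / N := by rw [← e]; gcongr
  have h3 : ((k : ℝ) + 1) / N = k / N + 1 / N := by ring
  constructor
  · rw [Subtype.dist_eq, coe_gridPoint hk.le, Real.dist_eq, abs_le]
    constructor <;> linarith
  · rw [Subtype.dist_eq, coe_gridPoint hk, Real.dist_eq, abs_le]
    push_cast
    constructor <;> linarith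

/-- The polygonal interpolations of a continuous function converge uniformly to it. -/
theorem tendsto_polyline_increments (f : C(I, ℝ)) (hf : f 0 = 0) :
    Tendsto (fun N : ℕ => polyline N fun k => f (gridPoint N (k + 1)) - f (gridPoint N k))
      atTop (𝓝 f) := by
  rw [Metric.tendsto_atTop]
  intro ε hε
  have huc := CompactSpace.uniformContinuous_of_continuous f.continuous
  obtain ⟨δ, hδ, hδf⟩ := Metric.uniformContinuous_iff.1 huc (ε / 2) (by positivity)
  obtain ⟨N₀, hN₀⟩ := exists_nat_one_div_lt hδ
  refine ⟨N₀ + 1, fun N hN => ?_⟩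
  have hNpos : 0 < N := by omega
  refine lt_of_le_of_lt ((ContinuousMap.dist_le (by positivity)).2 fun t => ?_)
    (half_lt_self hε)
  obtain ⟨k, hk, h1, h2⟩ := exists_cell hNpos t
  rw [polyline_increments_apply (fun k => f (gridPoint N k)) hk h1 h2, gridPoint_zero, hf, sub_zero]
  have hN' : 1 / (N : ℝ) < δ := by
    refine lt_of_le_of_lt ?_ hN₀
    exact one_div_le_one_div_of_le (by positivity) (by exact_mod_cast hN)
  have hd := dist_gridPoint_le hk h1 h2
  have ha := (hδf (hd.1.trans_lt hN')).le
  have hb := (hδf (hd.2.trans_lt hN')).le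
  rw [Real.dist_eq, abs_le] at ha hb ⊢
  constructor <;> nlinarith

end

noncomputable section

/-! ### The `b`-ary tree and the polygonal form of the cascade -/

/-- The word of length `n` whose letters are the base `b` digits of `k`, most significant first.
For `k < b ^ n` it labels the `k`-th `b`-adic interval of generation `n`. -/
def nodeWord (b : ℕ) [NeZero b] (n k : ℕ) : List (Fin b) :=
  List.ofFn fun i : Fin n => Fin.ofNat b (k / b ^ (n - 1 - i))

/-- The product of the weights along the branch of the tree from the root to the `k`-th node of
generation `n`. -/
def nodeProd {b : ℕ} [NeZero b] (ε : List (Fin b) → ℝ) (n k : ℕ) : ℝ :=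
  ∏ j ∈ Finset.Icc 1 n, ε (nodeWord b j (k / b ^ (n - j)))

variable {b : ℕ} [NeZero b]

theorem length_nodeWord (n k : ℕ) : (nodeWord b n k).length = n := by simp [nodeWord]

theorem nodeWord_injOn (n : ℕ) : Set.InjOn (nodeWord b n) (Set.Iio (b ^ n)) := by
  induction n with
  | zero => intro x hx y hy _; simp at hx hy; omega
  | succ n ih =>
    intro x hx y hy hxy
    simp only [nodeWord, List.ofFn_inj] at hxy
    have hb : 0 < b := NeZero.pos b
    have h1 : x / b = y / b := by
      refine ih ?_ ?_ ?_
      · simp only [Set.mem_Iio] at hx ⊢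
        exact Nat.div_lt_of_lt_mul (by rwa [← pow_succ'])
      · simp only [Set.mem_Iio] at hy ⊢
        exact Nat.div_lt_of_lt_mul (by rwa [← pow_succ'])
      · simp only [nodeWord, List.ofFn_inj]
        funext i
        have := congrFun hxy i.castSucc
        simp only [Fin.val_castSucc] at this
        have e : n + 1 - 1 - (i : ℕ) = (n - 1 - i) + 1 := by omega
        rw [e, pow_succ', ← Nat.div_div_eq_div_mul, ← Nat.div_div_eq_div_mul] at this
        exact this
    have h2 : x % b = y % b := by
      have := congrArg Fin.val (congrFun hxy (Fin.last n))
      simpa [Fin.ofNat] using this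
    rw [← Nat.div_add_mod x b, ← Nat.div_add_mod y b, h1, h2]

theorem nodeProd_zero (ε : List (Fin b) → ℝ) (k : ℕ) : nodeProd ε 0 k = 1 := by simp [nodeProd]

theorem nodeProd_succ (ε : List (Fin b) → ℝ) (n k : ℕ) :
    nodeProd ε (n + 1) k = nodeProd ε n (k / b) * ε (nodeWord b (n + 1) k) := by
  rw [nodeProd, Finset.prod_Icc_succ_top (by omega), nodeProd]
  congr 1
  · refine Finset.prod_congr rfl fun j hj => ?_
    have := (Finset.mem_Icc.1 hj).2
    rw [show n + 1 - j = (n - j) + 1 by omega, pow_succ', Nat.div_div_eq_div_mul]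
  · simp

theorem floor_mul_pow {n i j : ℕ} {u : ℝ} (hj : j ≤ n)
    (h1 : (i : ℝ) ≤ (b : ℝ) ^ n * u) (h2 : (b : ℝ) ^ n * u < i + 1) :
    ⌊u * (b : ℝ) ^ j⌋₊ = i / b ^ (n - j) := by
  have hb : (b : ℝ) ≠ 0 := NeZero.ne _
  have h : u * (b : ℝ) ^ j = (b : ℝ) ^ n * u / ((b ^ (n - j) : ℕ) : ℝ) := by
    push_cast
    rw [eq_div_iff (by positivity), mul_assoc, ← pow_add, Nat.add_sub_cancel' hj, mul_comm]
  have h0 : (0 : ℝ) ≤ (b : ℝ) ^ n * u := (Nat.cast_nonneg i).trans h1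
  rw [h, Nat.floor_div_natCast, (Nat.floor_eq_iff h0).2 ⟨h1, h2⟩]

/-- The product of the weights of the prefixes is constant on each half-open `b`-adic interval. -/
theorem prefixProd_eq_nodeProd (ε : List (Fin b) → ℝ) {n i : ℕ} {u : ℝ}
    (h1 : (i : ℝ) ≤ (b : ℝ) ^ n * u) (h2 : (b : ℝ) ^ n * u < i + 1) :
    prefixProd ε n u = nodeProd ε n i := by
  refine Finset.prod_congr rfl fun j hj => ?_
  have hj' := (Finset.mem_Icc.1 hj).2
  congr 1
  rw [digitWord, nodeWord, List.ofFn_inj]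
  funext l
  have hl := l.2
  rw [Real.digits, floor_mul_pow (n := n) (by omega : (l : ℕ) + 1 ≤ n) h1 h2,
    Nat.div_div_eq_div_mul, ← pow_add, show n - j + (j - 1 - (l : ℕ)) = n - (l + 1) by omega]

theorem integral_prefixProd_of_cell (ε : List (Fin b) → ℝ) {n i : ℕ} {x y : ℝ} (hxy : x ≤ y)
    (h1 : (i : ℝ) ≤ (b : ℝ) ^ n * x) (h2 : (b : ℝ) ^ n * y ≤ i + 1) :
    ∫ u in x..y, (b : ℝ) ^ n * prefixProd ε n u
      = ((b : ℝ) ^ n * y - (b : ℝ) ^ n * x) * nodeProd ε n i := by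
  have hb : (0 : ℝ) < (b : ℝ) ^ n := by have := NeZero.pos b; positivity
  have h : ∫ u in x..y, (b : ℝ) ^ n * prefixProd ε n u
      = ∫ _u in x..y, (b : ℝ) ^ n * nodeProd ε n i := by
    refine intervalIntegral.integral_congr_ae ?_
    have hy : ∀ᵐ u : ℝ, u ≠ y := by simp [ae_iff, measure_singleton]
    filter_upwards [hy] with u hu hmem
    rw [Set.uIoc_of_le hxy] at hmem
    have hlt : u < y := lt_of_le_of_ne hmem.2 hu
    rw [prefixProd_eq_nodeProd]
    · exact h1.trans (mul_le_mul_of_nonneg_left hmem.1.le hb.le)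
    · exact (mul_lt_mul_of_pos_left hlt hb).trans_le h2
  rw [h, intervalIntegral.integral_const, smul_eq_mul]
  ring

/-- The cascade path is polygonal, and its increments over the `b`-adic intervals of generation `n`
are the normalised products over the branches of the tree. -/
theorem cascadePath_eq_polyline (H : ℝ) (ε : List (Fin b) → ℝ) (n : ℕ) :
    cascadePath b H ε n
      = polyline (b ^ n) fun k => (b : ℝ) ^ (-((n : ℝ) * H)) * nodeProd ε n k := by
  have hb : 0 < b ^ n := Nat.pow_pos (NeZero.pos b)
  have hb' : (0 : ℝ) < (b : ℝ) ^ n := by exact_mod_cast hb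
  ext t
  obtain ⟨k, hk, h1, h2⟩ := exists_cell hb t
  rw [polyline_apply_of_mem_cell _ hk h1 h2]
  push_cast at h1 h2
  change (b : ℝ) ^ (-((n : ℝ) * H)) * ∫ u in (0 : ℝ)..(t : ℝ), (b : ℝ) ^ n * prefixProd ε n u = _
  have hcell : ∀ i : ℕ, (b : ℝ) ^ n * ((i : ℝ) / (b : ℝ) ^ n) = i := fun i => by field_simp
  have hle : (k : ℝ) / (b : ℝ) ^ n ≤ t := by
    rw [div_le_iff₀ hb']; linarith
  rw [← intervalIntegral.integral_add_adjacent_intervals (b := (k : ℝ) / (b : ℝ) ^ n)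
    (intervalIntegrable_prefixProd ε n _ _) (intervalIntegrable_prefixProd ε n _ _),
    integral_prefixProd_of_cell ε hle (by rw [hcell]) h2, hcell]
  have hsum := intervalIntegral.sum_integral_adjacent_intervals (n := k) (μ := volume)
    (a := fun i : ℕ => (i : ℝ) / (b : ℝ) ^ n)
    (f := fun u => (b : ℝ) ^ n * prefixProd ε n u)
    (fun i _ => intervalIntegrable_prefixProd ε n _ _)
  simp only [Nat.cast_zero, zero_div] at hsum
  rw [← hsum, mul_add, Finset.mul_sum]
  congr 1
  · refine Finset.sum_congr rfl fun i _ => ?_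
    rw [integral_prefixProd_of_cell (i := i) ε (by gcongr; simp) (by rw [hcell])
      (by rw [hcell]; push_cast; rfl), hcell, hcell]
    push_cast
    ring
  · push_cast
    ring

end

noncomputable section

/-! ### Peeling off the last generation of the cascade -/

theorem norm_prod_sub_prod_le_sum {ι : Type*} (s : Finset ι) (f g : ι → ℂ)
    (hf : ∀ i ∈ s, ‖f i‖ ≤ 1) (hg : ∀ i ∈ s, ‖g i‖ ≤ 1) :
    ‖∏ i ∈ s, f i - ∏ i ∈ s, g i‖ ≤ ∑ i ∈ s, ‖f i - g i‖ := by
  classical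
  induction s using Finset.induction_on with
  | empty => simp
  | insert a s ha ih =>
    rw [Finset.prod_insert ha, Finset.prod_insert ha, Finset.sum_insert ha]
    have h1 : f a * ∏ i ∈ s, f i - g a * ∏ i ∈ s, g i
        = (f a - g a) * ∏ i ∈ s, f i + g a * (∏ i ∈ s, f i - ∏ i ∈ s, g i) := by ring
    have h2 : ‖∏ i ∈ s, f i‖ ≤ 1 := by
      rw [norm_prod]
      exact Finset.prod_le_one (fun _ _ => norm_nonneg _)
        fun i hi => hf i (Finset.mem_insert_of_mem hi)
    rw [h1]
    refine (norm_add_le _ _).trans (add_le_add ?_ ?_)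
    · rw [norm_mul]
      exact mul_le_of_le_one_right (norm_nonneg _) h2
    · rw [norm_mul]
      exact (mul_le_of_le_one_left (norm_nonneg _) (hg a (Finset.mem_insert_self a s))).trans
        (ih (fun i hi => hf i (Finset.mem_insert_of_mem hi))
          fun i hi => hg i (Finset.mem_insert_of_mem hi))

theorem norm_exp_sub_quadratic_le {z : ℂ} (hz : ‖z‖ ≤ 1) :
    ‖Complex.exp z - (1 + z + z ^ 2 / 2)‖ ≤ ‖z‖ ^ 3 * (2 / 9) := by
  have h := Complex.exp_bound hz (n := 3) (by norm_num)
  simp only [Finset.sum_range_succ, Finset.sum_range_zero] at h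
  norm_num [Nat.factorial] at h
  exact h

/-- The characteristic function of a sign with mean `u` agrees to third order with that of a
Gaussian variable with the same mean and variance. -/
theorem norm_charFun_sign_sub_gaussian_le {u : ℝ} (hu : |u| ≤ 1) (s : ℝ) :
    ‖((1 + u) / 2 : ℂ) * Complex.exp (s * Complex.I)
      + ((1 - u) / 2 : ℂ) * Complex.exp (-s * Complex.I)
      - Complex.exp (u * s * Complex.I - (1 - u ^ 2) * s ^ 2 / 2)‖ ≤ 16 * |s| ^ 3 := by
  have hu' := abs_le.1 hu
  have hv0 : 0 ≤ 1 - u ^ 2 := by nlinarith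
  have hA : ‖((1 + u) / 2 : ℂ)‖ = (1 + u) / 2 := by
    rw [show ((1 + u) / 2 : ℂ) = (((1 + u) / 2 : ℝ) : ℂ) by push_cast; ring, Complex.norm_real,
      Real.norm_of_nonneg (by linarith)]
  have hB : ‖((1 - u) / 2 : ℂ)‖ = (1 - u) / 2 := by
    rw [show ((1 - u) / 2 : ℂ) = (((1 - u) / 2 : ℝ) : ℂ) by push_cast; ring, Complex.norm_real,
      Real.norm_of_nonneg (by linarith)]
  have hes : ‖Complex.exp (s * Complex.I)‖ = 1 := Complex.norm_exp_ofReal_mul_I s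
  have hes' : ‖Complex.exp (-s * Complex.I)‖ = 1 := by
    have := Complex.norm_exp_ofReal_mul_I (-s)
    push_cast at this
    exact this
  set z : ℂ := u * s * Complex.I - (1 - u ^ 2) * s ^ 2 / 2 with hz
  have hre : z.re ≤ 0 := by
    have : z = ((-((1 - u ^ 2) * s ^ 2 / 2) : ℝ) : ℂ) + ((u * s : ℝ) : ℂ) * Complex.I := by
      rw [hz]; push_cast; ring
    rw [this]
    simp only [Complex.add_re, Complex.ofReal_re, Complex.mul_re, Complex.I_re, Complex.ofReal_im,
      Complex.I_im]
    have := mul_nonneg hv0 (sq_nonneg s)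
    linarith
  rcases le_or_gt |s| (1 / 2) with hs | hs
  · have hs0 := abs_nonneg s
    have hu0 := abs_nonneg u
    have hzn : ‖z‖ ≤ 5 / 4 * |s| := by
      have h1 : ‖(u * s * Complex.I : ℂ)‖ = |u| * |s| := by simp
      have h2 : ‖((1 - u ^ 2) * s ^ 2 / 2 : ℂ)‖ = (1 - u ^ 2) * |s| ^ 2 / 2 := by
        rw [show ((1 - u ^ 2) * s ^ 2 / 2 : ℂ) = (((1 - u ^ 2) * s ^ 2 / 2 : ℝ) : ℂ) by
          push_cast; ring, Complex.norm_real, Real.norm_of_nonneg (by positivity), sq_abs]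
      refine (norm_sub_le _ _).trans ?_
      rw [h1, h2]
      nlinarith [sq_nonneg u, mul_nonneg hs0 (sub_nonneg.2 hs), mul_nonneg hs0 (sub_nonneg.2 hu),
        mul_nonneg (sq_nonneg u) (sq_nonneg |s|)]
    have e1 := norm_exp_sub_quadratic_le (z := s * Complex.I) (by simp; linarith)
    have e2 := norm_exp_sub_quadratic_le (z := -s * Complex.I) (by simp; linarith)
    have e3 := norm_exp_sub_quadratic_le (z := z) (by linarith)
    have n1 : ‖(s * Complex.I : ℂ)‖ = |s| := by simp
    have n2 : ‖(-s * Complex.I : ℂ)‖ = |s| := by simp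
    rw [n1] at e1
    rw [n2] at e2
    have key : ((1 + u) / 2 : ℂ) * Complex.exp (s * Complex.I)
          + ((1 - u) / 2 : ℂ) * Complex.exp (-s * Complex.I) - Complex.exp z
        = ((1 + u) / 2 : ℂ)
            * (Complex.exp (s * Complex.I) - (1 + s * Complex.I + (s * Complex.I) ^ 2 / 2))
          + ((1 - u) / 2 : ℂ)
            * (Complex.exp (-s * Complex.I) - (1 + -s * Complex.I + (-s * Complex.I) ^ 2 / 2))
          - (Complex.exp z - (1 + z + z ^ 2 / 2))
          + (((u * (1 - u ^ 2) / 2 * s ^ 3 : ℝ) : ℂ) * Complex.I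
            - (((1 - u ^ 2) ^ 2 / 8 * s ^ 4 : ℝ) : ℂ)) := by
      rw [hz]
      push_cast
      ring_nf
      simp only [Complex.I_sq]
      ring
    rw [key]
    have n3 : ‖(((u * (1 - u ^ 2) / 2 * s ^ 3 : ℝ) : ℂ) * Complex.I
            - (((1 - u ^ 2) ^ 2 / 8 * s ^ 4 : ℝ) : ℂ))‖ ≤ |s| ^ 3 := by
      refine (norm_sub_le _ _).trans ?_
      rw [norm_mul, Complex.norm_real, Complex.norm_real, Complex.norm_I, mul_one,
        Real.norm_eq_abs, Real.norm_eq_abs, abs_mul, abs_mul, abs_pow, abs_pow]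
      have a1 : |u * (1 - u ^ 2) / 2| ≤ 1 / 2 := by
        rw [abs_div, abs_mul, abs_of_nonneg hv0, abs_two]
        have : |u| * (1 - u ^ 2) ≤ 1 * 1 :=
          mul_le_mul hu (by nlinarith [sq_nonneg u]) hv0 zero_le_one
        linarith
      have a2 : |(1 - u ^ 2) ^ 2 / 8| ≤ 1 / 8 := by
        rw [abs_of_nonneg (by positivity)]
        have : (1 - u ^ 2) ^ 2 ≤ 1 := pow_le_one₀ hv0 (by nlinarith [sq_nonneg u])
        linarith
      have a3 : |s| ^ 4 ≤ |s| ^ 3 := pow_le_pow_of_le_one hs0 (by linarith) (by norm_num)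
      have b1 := mul_le_mul_of_nonneg_right a1 (pow_nonneg hs0 3)
      have b2 := mul_le_mul a2 a3 (pow_nonneg hs0 4) (by norm_num)
      nlinarith [pow_nonneg hs0 3]
    have hz3 : ‖z‖ ^ 3 ≤ 2 * |s| ^ 3 := by
      calc ‖z‖ ^ 3 ≤ (5 / 4 * |s|) ^ 3 := pow_le_pow_left₀ (norm_nonneg _) hzn 3
        _ = 125 / 64 * |s| ^ 3 := by ring
        _ ≤ 2 * |s| ^ 3 := by nlinarith [pow_nonneg hs0 3]
    refine (norm_add_le _ _).trans ?_
    refine (add_le_add ((norm_sub_le _ _).trans (add_le_add (norm_add_le _ _) le_rfl)) n3).trans ?_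
    rw [norm_mul, norm_mul, hA, hB]
    have c1 := mul_le_mul_of_nonneg_left e1 (by linarith : 0 ≤ (1 + u) / 2)
    have c2 := mul_le_mul_of_nonneg_left e2 (by linarith : 0 ≤ (1 - u) / 2)
    nlinarith [pow_nonneg hs0 3]
  · have h3 : (1 / 2 : ℝ) ^ 3 ≤ |s| ^ 3 := pow_le_pow_left₀ (by norm_num) hs.le 3
    have hez : ‖Complex.exp z‖ ≤ 1 := by
      rw [Complex.norm_exp]
      exact Real.exp_le_one_iff.2 hre
    refine (norm_sub_le _ _).trans ?_
    refine (add_le_add (norm_add_le _ _) hez).trans ?_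
    rw [norm_mul, norm_mul, hes, hes', hA, hB]
    nlinarith

/-- The square root of the inverse of `b`, the mean of the weights of the cascade. -/
def signMean (b : ℕ) : ℝ := (Real.sqrt b)⁻¹

theorem signMean_nonneg (b : ℕ) : 0 ≤ signMean b := by unfold signMean; positivity

theorem signMean_sq (b : ℕ) : signMean b ^ 2 = (b : ℝ)⁻¹ := by
  rw [signMean, inv_pow, Real.sq_sqrt (Nat.cast_nonneg b)]

theorem signMean_le_one (b : ℕ) [NeZero b] : signMean b ≤ 1 :=
  inv_le_one_of_one_le₀ (Real.one_le_sqrt.2 (by exact_mod_cast NeZero.pos b))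

theorem rpow_neg_half_eq_signMean (b : ℕ) : (b : ℝ) ^ ((1 / 2 : ℝ) - 1) = signMean b := by
  rw [signMean, Real.sqrt_eq_rpow, ← Real.rpow_neg (Nat.cast_nonneg b)]
  norm_num

theorem integral_signLaw {𝕜 : Type*} [NormedAddCommGroup 𝕜] [NormedSpace ℝ 𝕜] [CompleteSpace 𝕜]
    (b : ℕ) [NeZero b] (g : ℝ → 𝕜) :
    ∫ x, g x ∂(signLaw b (1 / 2))
      = ((1 + signMean b) / 2) • g 1 + ((1 - signMean b) / 2) • g (-1) := by
  have h0 := signMean_nonneg b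
  have h1 := signMean_le_one b
  have hint : ∀ (c : ENNReal) (x : ℝ), c ≠ ⊤ → Integrable g (c • Measure.dirac x) := by
    intro c x hc
    refine Integrable.smul_measure ?_ hc
    exact integrable_dirac enorm_lt_top
  rw [signLaw, rpow_neg_half_eq_signMean, integral_add_measure (hint _ _ ENNReal.ofReal_ne_top)
    (hint _ _ ENNReal.ofReal_ne_top), integral_smul_measure, integral_smul_measure, integral_dirac,
    integral_dirac, ENNReal.toReal_ofReal (by linarith), ENNReal.toReal_ofReal (by linarith)]
  congr 2
  ring

/-- If the family `B` is independent, and independent of `A`, then the integral of a product of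
functions of `A` and of the members of `B` can be computed by averaging each factor over its member
of `B` first. -/
theorem integral_prod_eq_integral_prod_integral {Ω α ι 𝕜 : Type*} [RCLike 𝕜] [Fintype ι]
    [MeasurableSpace Ω] [MeasurableSpace α] {P : Measure Ω} [IsProbabilityMeasure P]
    {A : Ω → α} {B : ι → Ω → ℝ} (hA : Measurable A) (hB : ∀ i, Measurable (B i))
    (hAB : IndepFun A (fun ω i => B i ω) P) (hBi : iIndepFun B P)
    {f : ι → α → ℝ → 𝕜} (hf : ∀ i, Measurable (Function.uncurry (f i)))
    (hint : Integrable (fun ω => ∏ i, f i (A ω) (B i ω)) P) :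
    ∫ ω, ∏ i, f i (A ω) (B i ω) ∂P = ∫ ω, ∏ i, (∫ x, f i (A ω) x ∂(P.map (B i))) ∂P := by
  have hBm : Measurable fun ω i => B i ω := measurable_pi_lambda _ hB
  have hpair : Measurable fun ω => (A ω, fun i => B i ω) := hA.prodMk hBm
  have hF : Measurable fun y : α × (ι → ℝ) => ∏ i, f i y.1 (y.2 i) :=
    Finset.measurable_prod _ fun i _ =>
      (hf i).comp (measurable_fst.prodMk ((measurable_pi_apply i).comp measurable_snd))
  have hmap := (indepFun_iff_map_prod_eq_prod_map_map hA.aemeasurable hBm.aemeasurable).1 hAB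
  have hprob : ∀ i, IsProbabilityMeasure (P.map (B i)) := fun i =>
    Measure.isProbabilityMeasure_map (hB i).aemeasurable
  have hpi := (iIndepFun_iff_map_fun_eq_pi_map fun i => (hB i).aemeasurable).1 hBi
  have h1 : ∫ ω, ∏ i, f i (A ω) (B i ω) ∂P
      = ∫ y, ∏ i, f i y.1 (y.2 i) ∂(P.map fun ω => (A ω, fun i => B i ω)) :=
    (integral_map hpair.aemeasurable hF.aestronglyMeasurable).symm
  have hint' : Integrable (fun y : α × (ι → ℝ) => ∏ i, f i y.1 (y.2 i))
      (P.map fun ω => (A ω, fun i => B i ω)) :=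
    (integrable_map_measure hF.aestronglyMeasurable hpair.aemeasurable).2 hint
  have : IsProbabilityMeasure (P.map fun ω i => B i ω) :=
    Measure.isProbabilityMeasure_map hBm.aemeasurable
  have : IsProbabilityMeasure (P.map A) := Measure.isProbabilityMeasure_map hA.aemeasurable
  rw [hmap] at h1 hint'
  rw [h1, integral_prod _ hint']
  rw [integral_map hA.aemeasurable hint'.aestronglyMeasurable.integral_prod_right']
  refine integral_congr_ae (ae_of_all _ fun ω => ?_)
  simp only
  rw [hpi]
  exact integral_fintype_prod_eq_prod (fun i x => f i (A ω) x)

variable {b : ℕ} [NeZero b] {Ω : Type*} {ε : List (Fin b) → Ω → ℝ}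

/-- The linear combination with coefficients `s` of the products over the branches of length `n`. -/
def nodeForm (ε : List (Fin b) → Ω → ℝ) (n : ℕ) (s : ℕ → ℝ) (ω : Ω) : ℝ :=
  ∑ k ∈ Finset.range (b ^ n), s k * nodeProd (fun w => ε w ω) n k

/-- A linear form in the products at the parents of the nodes of generation `n + 1` is a linear form
of generation `n`. -/
theorem nodeForm_parent (n : ℕ) (s : ℕ → ℝ) (c : ℝ) (ω : Ω) :
    ∑ k ∈ Finset.range (b ^ (n + 1)), c * s k * nodeProd (fun w => ε w ω) n (k / b)
      = nodeForm ε n (fun j => c * blockSum b s j) ω := by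
  rw [pow_succ, sum_range_mul_eq_sum_blocks, nodeForm]
  refine Finset.sum_congr rfl fun j _ => ?_
  rw [blockSum, Finset.mul_sum, Finset.sum_mul]
  refine Finset.sum_congr rfl fun l hl => ?_
  have hl' := Finset.mem_range.1 hl
  have : (j * b + l) / b = j := by
    rw [mul_comm, Nat.mul_add_div (NeZero.pos b), Nat.div_eq_of_lt hl', add_zero]
  rw [this]

variable [MeasurableSpace Ω] {P : Measure Ω}

/-- The hypotheses on the weights of the cascade, with the weights equal to `1` or `-1` everywhere
and not only almost surely. -/
structure IsSignCascade (ε : List (Fin b) → Ω → ℝ) (P : Measure Ω) : Prop where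
  measurable : ∀ w, Measurable (ε w)
  law : ∀ w, P.map (ε w) = signLaw b (1 / 2)
  indep : iIndepFun ε P
  sign : ∀ w ω, ε w ω = 1 ∨ ε w ω = -1

theorem IsSignCascade.nodeProd_sign (hε : IsSignCascade ε P) (n k : ℕ) (ω : Ω) :
    nodeProd (fun w => ε w ω) n k = 1 ∨ nodeProd (fun w => ε w ω) n k = -1 := by
  induction n generalizing k with
  | zero => left; exact nodeProd_zero _ _
  | succ n ih =>
    rw [nodeProd_succ]
    rcases ih (k / b) with h | h <;> rcases hε.sign (nodeWord b (n + 1) k) ω with h' | h' <;>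
      simp [h, h']

theorem IsSignCascade.measurable_nodeProd (hε : IsSignCascade ε P) (n k : ℕ) :
    Measurable fun ω => nodeProd (fun w => ε w ω) n k :=
  Finset.measurable_prod _ fun _ _ => hε.measurable _

theorem IsSignCascade.measurable_nodeForm (hε : IsSignCascade ε P) (n : ℕ) (s : ℕ → ℝ) :
    Measurable (nodeForm ε n s) :=
  Finset.measurable_sum _ fun _ _ => (hε.measurable_nodeProd _ _).const_mul _

theorem IsSignCascade.abs_nodeForm_le (hε : IsSignCascade ε P) (n : ℕ) (s : ℕ → ℝ) (ω : Ω) :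
    |nodeForm ε n s ω| ≤ ∑ k ∈ Finset.range (b ^ n), |s k| := by
  refine (Finset.abs_sum_le_sum_abs _ _).trans (Finset.sum_le_sum fun k _ => ?_)
  rw [abs_mul]
  rcases hε.nodeProd_sign n k ω with h | h <;> simp [h]

/-- The weights of generation `n + 1` are independent of the products over the branches of length
`n`. -/
theorem IsSignCascade.indepFun_nodeProd (hε : IsSignCascade ε P) (n : ℕ) :
    IndepFun (fun ω j => nodeProd (fun w => ε w ω) n j)
      (fun ω (k : Fin (b ^ (n + 1))) => ε (nodeWord b (n + 1) k) ω) P := by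
  classical
  set S : Finset (List (Fin b)) := (List.finite_length_le (Fin b) n).toFinset with hS
  set T : Finset (List (Fin b)) := (List.finite_length_eq (Fin b) (n + 1)).toFinset with hT
  have hST : Disjoint S T := by
    rw [Finset.disjoint_left]
    intro w hw hw'
    simp only [hS, hT, Set.Finite.mem_toFinset, Set.mem_ofPred_eq] at hw hw'
    omega
  have h := hε.indep.indepFun_finset S T hST hε.measurable
  have hSm : ∀ j ∈ Finset.Icc 1 n, ∀ k, nodeWord b j k ∈ S := by
    intro j hj k
    simp only [hS, Set.Finite.mem_toFinset, Set.mem_ofPred_eq, length_nodeWord]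
    exact (Finset.mem_Icc.1 hj).2
  have hTm : ∀ k, nodeWord b (n + 1) k ∈ T := by
    intro k
    simp only [hT, Set.Finite.mem_toFinset, Set.mem_ofPred_eq, length_nodeWord]
  let φ : (S → ℝ) → ℕ → ℝ := fun v k =>
    nodeProd (fun w => if h : w ∈ S then v ⟨w, h⟩ else 0) n k
  have hφ : Measurable φ := by
    refine measurable_pi_lambda _ fun k => Finset.measurable_prod _ fun j _ => ?_
    by_cases h : nodeWord b j (k / b ^ (n - j)) ∈ S
    · simpa only [dif_pos h] using measurable_pi_apply _
    · simpa only [dif_neg h] using measurable_const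
  let ψ : (T → ℝ) → Fin (b ^ (n + 1)) → ℝ := fun v k => v ⟨_, hTm k⟩
  have hψ : Measurable ψ := measurable_pi_lambda _ fun k => measurable_pi_apply _
  have h2 := h.comp hφ hψ
  have h3 : (fun ω j => nodeProd (fun w => ε w ω) n j) = φ ∘ fun ω (i : S) => ε i ω := by
    funext ω k
    simp only [Function.comp, φ]
    refine Finset.prod_congr rfl fun j hj => ?_
    simp only [dif_pos (hSm j hj _)]
  rw [h3]
  exact h2

variable [IsProbabilityMeasure P]

/-- Conditioning on the first `n` generations: each weight of generation `n + 1` is averaged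
separately, and it turns the product at the parent into itself or its opposite. -/
theorem IsSignCascade.integral_prod_succ {𝕜 : Type*} [RCLike 𝕜] (hε : IsSignCascade ε P) (n : ℕ)
    (f : ℕ → ℝ → 𝕜) (hf : ∀ k, Measurable (f k)) :
    ∫ ω, ∏ k ∈ Finset.range (b ^ (n + 1)), f k (nodeProd (fun w => ε w ω) (n + 1) k) ∂P
      = ∫ ω, ∏ k ∈ Finset.range (b ^ (n + 1)),
          (((1 + signMean b) / 2) • f k (nodeProd (fun w => ε w ω) n (k / b))
            + ((1 - signMean b) / 2) • f k (-nodeProd (fun w => ε w ω) n (k / b))) ∂P := by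
  have hiB : iIndepFun (fun (k : Fin (b ^ (n + 1))) => ε (nodeWord b (n + 1) k)) P := by
    refine hε.indep.precomp (g := fun k : Fin (b ^ (n + 1)) => nodeWord b (n + 1) k) ?_
    intro x y hxy
    exact Fin.ext (nodeWord_injOn (n + 1) x.2 y.2 hxy)
  have hA : Measurable fun ω j => nodeProd (fun w => ε w ω) n j :=
    measurable_pi_lambda _ fun j => hε.measurable_nodeProd n j
  have key := integral_prod_eq_integral_prod_integral (𝕜 := 𝕜) (P := P) hA
    (fun k : Fin (b ^ (n + 1)) => hε.measurable (nodeWord b (n + 1) k)) (hε.indepFun_nodeProd n) hiB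
    (f := fun k a x => f k (a ((k : ℕ) / b) * x)) ?_ ?_
  · simp_rw [Finset.prod_range, nodeProd_succ]
    refine key.trans (integral_congr_ae (ae_of_all _ fun ω => ?_))
    refine Finset.prod_congr rfl fun k _ => ?_
    rw [hε.law, integral_signLaw]
    simp
  · intro k
    refine (hf k).comp ?_
    exact ((measurable_pi_apply _).comp measurable_fst).mul measurable_snd
  · refine Integrable.of_bound (C := ∏ k : Fin (b ^ (n + 1)), (‖f k 1‖ + ‖f k (-1)‖)) ?_ ?_
    · refine (Finset.measurable_prod _ fun k _ => ?_).aestronglyMeasurable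
      exact (hf k).comp ((hε.measurable_nodeProd n _).mul (hε.measurable _))
    · refine ae_of_all _ fun ω => ?_
      rw [norm_prod]
      refine Finset.prod_le_prod (fun _ _ => norm_nonneg _) fun k _ => ?_
      rcases hε.nodeProd_sign n (k / b) ω with h | h <;>
        rcases hε.sign (nodeWord b (n + 1) k) ω with h' | h' <;> simp [h, h']

/-- Averaging over the weights of the last generation replaces, up to third order, a linear form
of generation `n + 1` by one of generation `n` plus an independent Gaussian variable. -/
theorem IsSignCascade.norm_charFun_nodeForm_succ_sub_le (hε : IsSignCascade ε P) (n : ℕ)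
    (s : ℕ → ℝ) :
    ‖∫ ω, Complex.exp (nodeForm ε (n + 1) s ω * Complex.I) ∂P
      - Complex.exp (-((1 - signMean b ^ 2) * (∑ k ∈ Finset.range (b ^ (n + 1)), s k ^ 2) / 2))
        * ∫ ω, Complex.exp (nodeForm ε n (fun j => signMean b * blockSum b s j) ω * Complex.I) ∂P‖
      ≤ 16 * ∑ k ∈ Finset.range (b ^ (n + 1)), |s k| ^ 3 := by
  set u := signMean b with hu
  have hu0 : 0 ≤ u := signMean_nonneg b
  have hu1 : u ≤ 1 := signMean_le_one b
  have h1 : ∀ ω, Complex.exp (nodeForm ε (n + 1) s ω * Complex.I)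
      = ∏ k ∈ Finset.range (b ^ (n + 1)),
        Complex.exp ((s k * nodeProd (fun w => ε w ω) (n + 1) k : ℝ) * Complex.I) := by
    intro ω
    rw [← Complex.exp_sum, nodeForm, Complex.ofReal_sum, Finset.sum_mul]
  have hstep := hε.integral_prod_succ n
    (fun k x => Complex.exp ((s k * x : ℝ) * Complex.I)) (fun k => by fun_prop)
  simp_rw [h1]
  rw [hstep, ← integral_const_mul]
  have h2 : ∀ ω, Complex.exp (-((1 - (u : ℂ) ^ 2)
        * (∑ k ∈ Finset.range (b ^ (n + 1)), (s k : ℂ) ^ 2) / 2))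
        * Complex.exp (nodeForm ε n (fun j => u * blockSum b s j) ω * Complex.I)
      = ∏ k ∈ Finset.range (b ^ (n + 1)),
        Complex.exp (u * s k * nodeProd (fun w => ε w ω) n (k / b) * Complex.I
          - (1 - u ^ 2) * s k ^ 2 / 2) := by
    intro ω
    rw [← Complex.exp_sum, ← Complex.exp_add, ← nodeForm_parent]
    congr 1
    push_cast
    rw [Finset.sum_sub_distrib, Finset.sum_mul, Finset.mul_sum, Finset.sum_div]
    ring
  push_cast
  simp_rw [h2]
  have hpt : ∀ ω, ∀ k,
      ‖(((1 + u) / 2) • Complex.exp ((s k : ℂ) * nodeProd (fun w => ε w ω) n (k / b)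
        * Complex.I) + ((1 - u) / 2) • Complex.exp ((s k : ℂ) * -nodeProd (fun w => ε w ω) n (k / b)
        * Complex.I)) - Complex.exp (u * s k * nodeProd (fun w => ε w ω) n (k / b) * Complex.I
          - (1 - u ^ 2) * s k ^ 2 / 2)‖ ≤ 16 * |s k| ^ 3 := by
    intro ω k
    rcases hε.nodeProd_sign n (k / b) ω with h | h
    · have := norm_charFun_sign_sub_gaussian_le (abs_le.2 ⟨by linarith, hu1⟩) (s k)
      rw [h]
      convert this using 2
      simp [Complex.real_smul]
    · have := norm_charFun_sign_sub_gaussian_le (u := -u)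
        (by rw [abs_neg]; exact abs_le.2 ⟨by linarith, hu1⟩) (s k)
      rw [h]
      convert this using 2
      simp [Complex.real_smul]
      ring
  have hn1 : ∀ ω, ∀ k,
      ‖(((1 + u) / 2) • Complex.exp ((s k : ℂ) * nodeProd (fun w => ε w ω) n (k / b)
        * Complex.I) + ((1 - u) / 2) • Complex.exp ((s k : ℂ) * -nodeProd (fun w => ε w ω) n (k / b)
        * Complex.I))‖ ≤ 1 := by
    intro ω k
    have e1 := Complex.norm_exp_ofReal_mul_I (s k * nodeProd (fun w => ε w ω) n (k / b))
    have e2 := Complex.norm_exp_ofReal_mul_I (s k * -nodeProd (fun w => ε w ω) n (k / b))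
    push_cast at e1 e2
    refine (norm_add_le _ _).trans ?_
    rw [norm_smul, norm_smul, e1, e2, Real.norm_of_nonneg (by linarith),
      Real.norm_of_nonneg (by linarith)]
    linarith
  have hn2 : ∀ ω, ∀ k, ‖Complex.exp (u * s k * nodeProd (fun w => ε w ω) n (k / b) * Complex.I
          - (1 - u ^ 2) * s k ^ 2 / 2)‖ ≤ 1 := by
    intro ω k
    rw [show (u * s k * nodeProd (fun w => ε w ω) n (k / b) * Complex.I
          - (1 - u ^ 2) * s k ^ 2 / 2 : ℂ)
        = ((-((1 - u ^ 2) * s k ^ 2 / 2) : ℝ) : ℂ)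
          + ((u * s k * nodeProd (fun w => ε w ω) n (k / b) : ℝ) : ℂ) * Complex.I by
          push_cast; ring, Complex.exp_add, norm_mul, Complex.norm_exp_ofReal_mul_I, mul_one,
      Complex.norm_exp, Complex.ofReal_re]
    refine Real.exp_le_one_iff.2 ?_
    have : 0 ≤ 1 - u ^ 2 := by nlinarith
    have := mul_nonneg this (sq_nonneg (s k))
    linarith
  have hQ : ∀ k, Measurable fun ω => nodeProd (fun w => ε w ω) n k := hε.measurable_nodeProd n
  have hQ' : ∀ k, Measurable fun ω => (nodeProd (fun w => ε w ω) n k : ℂ) := fun k =>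
    Complex.measurable_ofReal.comp (hQ k)
  rw [← integral_sub]
  · refine (norm_integral_le_of_norm_le_const
      (C := 16 * ∑ k ∈ Finset.range (b ^ (n + 1)), |s k| ^ 3) (ae_of_all _ fun ω => ?_)).trans ?_
    · refine (norm_prod_sub_prod_le_sum _ _ _ (fun k _ => hn1 ω k) fun k _ => hn2 ω k).trans ?_
      rw [Finset.mul_sum]
      exact Finset.sum_le_sum fun k _ => hpt ω k
    · simp
  · refine Integrable.of_bound (C := 1) ?_ (ae_of_all _ fun ω => ?_)
    · refine (Finset.measurable_prod _ fun k _ => ?_).aestronglyMeasurable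
      have := hQ' (k / b)
      fun_prop
    · rw [norm_prod]
      exact Finset.prod_le_one (fun _ _ => norm_nonneg _) fun k _ => hn1 ω k
  · refine Integrable.of_bound (C := 1) ?_ (ae_of_all _ fun ω => ?_)
    · refine (Finset.measurable_prod _ fun k _ => ?_).aestronglyMeasurable
      have := hQ' (k / b)
      fun_prop
    · rw [norm_prod]
      exact Finset.prod_le_one (fun _ _ => norm_nonneg _) fun k _ => hn2 ω k

/-- Hoeffding's inequality for one weight. -/
theorem IsSignCascade.mgf_sign_le (hε : IsSignCascade ε P) (s : ℝ) :
    (1 + signMean b) / 2 * Real.exp s + (1 - signMean b) / 2 * Real.exp (-s)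
      ≤ Real.exp (signMean b * s + s ^ 2 / 2) := by
  have hint : ∀ g : ℝ → ℝ, Measurable g → ∫ ω, g (ε [] ω) ∂P
      = (1 + signMean b) / 2 * g 1 + (1 - signMean b) / 2 * g (-1) := by
    intro g hg
    rw [← integral_map (hε.measurable []).aemeasurable hg.aestronglyMeasurable, hε.law,
      integral_signLaw]
    simp
  have hmean : ∫ ω, ε [] ω ∂P = signMean b := by
    rw [hint (fun x => x) measurable_id]
    ring
  have h := (hasSubgaussianMGF_of_mem_Icc (a := -1) (b := 1) (μ := P) (X := ε [])
    (hε.measurable []).aemeasurable (ae_of_all _ fun ω => by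
      rcases hε.sign [] ω with h | h <;> simp [h])).mgf_le s
  rw [mgf, hmean, hint (fun x => Real.exp (s * (x - signMean b))) (by fun_prop)] at h
  have e1 : Real.exp (s * (1 - signMean b)) = Real.exp s * Real.exp (-(signMean b * s)) := by
    rw [← Real.exp_add]; ring_nf
  have e2 : Real.exp (s * (-1 - signMean b)) = Real.exp (-s) * Real.exp (-(signMean b * s)) := by
    rw [← Real.exp_add]; ring_nf
  have e3 : ((((‖(1 : ℝ) - -1‖₊ / 2) ^ 2 : NNReal) : ℝ)) = 1 := by
    push_cast
    norm_num
  rw [e1, e2, e3, one_mul] at h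
  have h' := mul_le_mul_of_nonneg_right h (Real.exp_pos (signMean b * s)).le
  rw [← Real.exp_add (s ^ 2 / 2)] at h'
  have e4 : Real.exp (-(signMean b * s)) * Real.exp (signMean b * s) = 1 := by
    rw [← Real.exp_add]; simp
  calc _ = ((1 + signMean b) / 2 * Real.exp s + (1 - signMean b) / 2 * Real.exp (-s))
        * (Real.exp (-(signMean b * s)) * Real.exp (signMean b * s)) := by rw [e4, mul_one]
    _ ≤ _ := by
      rw [add_comm (signMean b * s)]
      refine le_trans (le_of_eq ?_) h'
      ring

theorem IsSignCascade.integrable_exp_nodeForm (hε : IsSignCascade ε P) (n : ℕ) (s : ℕ → ℝ) :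
    Integrable (fun ω => Real.exp (nodeForm ε n s ω)) P := by
  refine Integrable.of_bound (C := Real.exp (∑ k ∈ Finset.range (b ^ n), |s k|))
    (hε.measurable_nodeForm n s).exp.aestronglyMeasurable (ae_of_all _ fun ω => ?_)
  rw [Real.norm_of_nonneg (Real.exp_pos _).le]
  exact Real.exp_le_exp.2 ((le_abs_self _).trans (hε.abs_nodeForm_le n s ω))

/-- The sub-Gaussian counterpart of `IsSignCascade.norm_charFun_nodeForm_succ_sub_le`. -/
theorem IsSignCascade.mgf_nodeForm_succ_le (hε : IsSignCascade ε P) (n : ℕ) (s : ℕ → ℝ) :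
    ∫ ω, Real.exp (nodeForm ε (n + 1) s ω) ∂P
      ≤ Real.exp ((∑ k ∈ Finset.range (b ^ (n + 1)), s k ^ 2) / 2)
        * ∫ ω, Real.exp (nodeForm ε n (fun j => signMean b * blockSum b s j) ω) ∂P := by
  have h1 : ∀ ω, Real.exp (nodeForm ε (n + 1) s ω)
      = ∏ k ∈ Finset.range (b ^ (n + 1)),
        Real.exp (s k * nodeProd (fun w => ε w ω) (n + 1) k) := by
    intro ω
    rw [← Real.exp_sum, nodeForm]
  have hstep := hε.integral_prod_succ n
    (fun k x => Real.exp (s k * x)) (fun k => by fun_prop)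
  simp_rw [h1]
  rw [hstep, ← integral_const_mul]
  have h2 : ∀ ω, Real.exp ((∑ k ∈ Finset.range (b ^ (n + 1)), s k ^ 2) / 2)
        * Real.exp (nodeForm ε n (fun j => signMean b * blockSum b s j) ω)
      = ∏ k ∈ Finset.range (b ^ (n + 1)),
        Real.exp (signMean b * s k * nodeProd (fun w => ε w ω) n (k / b) + s k ^ 2 / 2) := by
    intro ω
    rw [← Real.exp_sum, ← Real.exp_add, ← nodeForm_parent, Finset.sum_add_distrib, Finset.sum_div,
      add_comm]
  have hu0 := signMean_nonneg b
  have hu1 := signMean_le_one b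
  refine integral_mono_of_nonneg (ae_of_all _ fun ω => ?_)
    ((hε.integrable_exp_nodeForm n _).const_mul _) (ae_of_all _ fun ω => ?_)
  · refine Finset.prod_nonneg fun k _ => ?_
    simp only [smul_eq_mul]
    have := Real.exp_pos (s k * nodeProd (fun w => ε w ω) n (k / b))
    have := Real.exp_pos (s k * -nodeProd (fun w => ε w ω) n (k / b))
    have : 0 ≤ (1 - signMean b) / 2 := by linarith
    positivity
  · simp only [h2, smul_eq_mul]
    refine Finset.prod_le_prod (fun k _ => ?_) fun k _ => ?_
    · have := Real.exp_pos (s k * nodeProd (fun w => ε w ω) n (k / b))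
      have := Real.exp_pos (s k * -nodeProd (fun w => ε w ω) n (k / b))
      have : 0 ≤ (1 - signMean b) / 2 := by linarith
      positivity
    · rcases hε.nodeProd_sign n (k / b) ω with h | h
      · have := hε.mgf_sign_le (s k)
        simpa [h] using this
      · have := hε.mgf_sign_le (-s k)
        simpa [h] using this

end

noncomputable section

/-! ### Increments of the cascade over the intervals of a fixed generation -/

/-- The coefficients, in generation `m + p`, of the linear form whose coefficient is constant on the
descendants of each node `w` of generation `m`, equal to `b ^ (-(m + p) / 2) * θ w`. -/
def levelCoeff (b m p : ℕ) (θ : ℕ → ℝ) (k : ℕ) : ℝ := signMean b ^ (m + p) * θ (k / b ^ p)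

theorem levelCoeff_zero (b m : ℕ) (θ : ℕ → ℝ) (k : ℕ) :
    levelCoeff b m 0 θ k = signMean b ^ m * θ k := by simp [levelCoeff]

section

variable {b : ℕ} [NeZero b]

theorem signMean_sq_mul : signMean b ^ 2 * b = 1 := by
  rw [signMean_sq, inv_mul_cancel₀ (NeZero.ne (b : ℝ))]

/-- The normalisation `b ^ (-n / 2)` makes the coefficients compatible with the passage from one
generation to the previous one. -/
theorem signMean_mul_blockSum_levelCoeff (m p : ℕ) (θ : ℕ → ℝ) :
    (fun j => signMean b * blockSum b (levelCoeff b m (p + 1) θ) j) = levelCoeff b m p θ := by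
  funext j
  have h : ∀ l ∈ Finset.range b, levelCoeff b m (p + 1) θ (j * b + l)
      = signMean b ^ (m + p + 1) * θ (j / b ^ p) := by
    intro l hl
    rw [levelCoeff, pow_succ', ← Nat.div_div_eq_div_mul, mul_comm j,
      Nat.mul_add_div (NeZero.pos b), Nat.div_eq_of_lt (Finset.mem_range.1 hl), add_zero, add_assoc]
  rw [blockSum, Finset.sum_congr rfl h, Finset.sum_const, Finset.card_range, nsmul_eq_mul,
    levelCoeff]
  calc _ = signMean b ^ 2 * b * (signMean b ^ (m + p) * θ (j / b ^ p)) := by ring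
    _ = _ := by rw [signMean_sq_mul, one_mul]

theorem sum_levelCoeff_sq (m p : ℕ) (θ : ℕ → ℝ) :
    ∑ k ∈ Finset.range (b ^ (m + p)), levelCoeff b m p θ k ^ 2
      = signMean b ^ (2 * m) * ∑ w ∈ Finset.range (b ^ m), θ w ^ 2 := by
  simp only [levelCoeff, mul_pow]
  rw [← Finset.mul_sum, pow_add b,
    sum_range_mul_comp_div _ (Nat.pow_pos (NeZero.pos b)) (fun w => θ w ^ 2), nsmul_eq_mul]
  push_cast
  have : (signMean b ^ (m + p)) ^ 2 * (b : ℝ) ^ p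
      = signMean b ^ (2 * m) * (signMean b ^ 2 * b) ^ p := by ring
  rw [← mul_assoc, this, signMean_sq_mul, one_pow, mul_one]

theorem sum_abs_levelCoeff_pow_three_le (m p : ℕ) (θ : ℕ → ℝ) :
    ∑ k ∈ Finset.range (b ^ (m + p)), |levelCoeff b m p θ k| ^ 3
      ≤ ∑ w ∈ Finset.range (b ^ m), |θ w| ^ 3 := by
  have h0 := signMean_nonneg b
  simp only [levelCoeff, abs_mul, mul_pow]
  rw [← Finset.mul_sum, pow_add b,
    sum_range_mul_comp_div _ (Nat.pow_pos (NeZero.pos b)) (fun w => |θ w| ^ 3), nsmul_eq_mul]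
  push_cast
  have : |signMean b ^ (m + p)| ^ 3 * (b : ℝ) ^ p
      = signMean b ^ (3 * m + p) * (signMean b ^ 2 * b) ^ p := by
    rw [abs_of_nonneg (by positivity)]; ring
  rw [← mul_assoc, this, signMean_sq_mul, one_pow, mul_one]
  exact mul_le_of_le_one_left (Finset.sum_nonneg fun _ _ => by positivity)
    (pow_le_one₀ h0 (signMean_le_one b))

variable {Ω : Type*} {ε : List (Fin b) → Ω → ℝ}

/-- The increments over the intervals of generation `m` of the path of generation `m + p`,
multiplied by `c`. -/
def cascadeIncr (ε : List (Fin b) → Ω → ℝ) (c : ℝ) (m p : ℕ) (w : ℕ) (ω : Ω) : ℝ :=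
  blockSum (b ^ p) (fun k => c * (signMean b ^ (m + p) * nodeProd (fun w => ε w ω) (m + p) k)) w

theorem sum_mul_cascadeIncr (c : ℝ) (m p : ℕ) (θ : ℕ → ℝ) (ω : Ω) :
    ∑ w ∈ Finset.range (b ^ m), θ w * cascadeIncr ε c m p w ω
      = nodeForm ε (m + p) (levelCoeff b m p fun w => c * θ w) ω := by
  rw [nodeForm, pow_add b, sum_range_mul_eq_sum_blocks]
  refine Finset.sum_congr rfl fun w _ => ?_
  rw [cascadeIncr, blockSum, Finset.mul_sum]
  refine Finset.sum_congr rfl fun l hl => ?_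
  rw [levelCoeff, mul_comm w, Nat.mul_add_div (Nat.pow_pos (NeZero.pos b)),
    Nat.div_eq_of_lt (Finset.mem_range.1 hl), add_zero]
  ring

/-- The increments over the intervals of generation `m` are sums of `b` increments over those of
generation `m + 1`, for the same path. -/
theorem cascadeIncr_refine (c : ℝ) (m p : ℕ) (ω : Ω) :
    (fun w => cascadeIncr ε c m (p + 1) w ω)
      = blockSum b fun w => cascadeIncr ε c (m + 1) p w ω := by
  funext w
  simp only [cascadeIncr]
  rw [pow_succ', blockSum_mul, show m + (p + 1) = m + 1 + p by ring]

theorem smul_cascadePath_eq_polyline (c : ℝ) (n : ℕ) (ω : Ω) :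
    c • cascadePath b (1 / 2) (fun w => ε w ω) n
      = polyline (b ^ n) fun w => cascadeIncr ε c n 0 w ω := by
  have h : (b : ℝ) ^ (-((n : ℝ) * (1 / 2))) = signMean b ^ n := by
    rw [signMean, Real.sqrt_eq_rpow, ← Real.rpow_neg (Nat.cast_nonneg b), ← Real.rpow_natCast,
      ← Real.rpow_mul (Nat.cast_nonneg b)]
    congr 1
    ring
  rw [cascadePath_eq_polyline, polyline, Finset.smul_sum, polyline]
  refine Finset.sum_congr rfl fun k _ => ?_
  rw [smul_smul, h, cascadeIncr, pow_zero, blockSum_one, add_zero]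

variable [MeasurableSpace Ω] {P : Measure Ω}

theorem IsSignCascade.measurable_cascadeIncr (hε : IsSignCascade ε P) (c : ℝ) (m p w : ℕ) :
    Measurable fun ω => cascadeIncr ε c m p w ω := by
  simp only [cascadeIncr, blockSum]
  exact Finset.measurable_sum _ fun _ _ => ((hε.measurable_nodeProd _ _).const_mul _).const_mul _

theorem IsSignCascade.exists_abs_cascadeIncr_le (hε : IsSignCascade ε P) (c : ℝ) (m p w : ℕ) :
    ∃ C, ∀ ω, |cascadeIncr ε c m p w ω| ≤ C := by
  refine ⟨∑ _l ∈ Finset.range (b ^ p), |c| * |signMean b ^ (m + p)|, fun ω => ?_⟩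
  rw [cascadeIncr, blockSum]
  refine (Finset.abs_sum_le_sum_abs _ _).trans (Finset.sum_le_sum fun l _ => ?_)
  rw [abs_mul, abs_mul]
  rcases hε.nodeProd_sign (m + p) (w * b ^ p + l) ω with h | h <;> simp [h]

variable [IsProbabilityMeasure P]

/-- Peeling off `p` generations one after the other. Each step contributes the same Gaussian factor,
since `sum_levelCoeff_sq` does not depend on `p`, and the errors add up. -/
theorem IsSignCascade.norm_charFun_levelCoeff_sub_le (hε : IsSignCascade ε P) (m p : ℕ)
    (θ : ℕ → ℝ) :
    ‖∫ ω, Complex.exp (nodeForm ε (m + p) (levelCoeff b m p θ) ω * Complex.I) ∂P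
      - (Real.exp (-((1 - signMean b ^ 2)
          * (signMean b ^ (2 * m) * ∑ w ∈ Finset.range (b ^ m), θ w ^ 2) / 2) * p) : ℂ)
        * ∫ ω, Complex.exp (nodeForm ε m (levelCoeff b m 0 θ) ω * Complex.I) ∂P‖
      ≤ 16 * p * ∑ w ∈ Finset.range (b ^ m), |θ w| ^ 3 := by
  set V := (1 - signMean b ^ 2)
          * (signMean b ^ (2 * m) * ∑ w ∈ Finset.range (b ^ m), θ w ^ 2) / 2 with hV
  have hV0 : 0 ≤ V := by
    have h1 := signMean_le_one b
    have h0 := signMean_nonneg b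
    have : 0 ≤ 1 - signMean b ^ 2 := by nlinarith
    have : 0 ≤ ∑ w ∈ Finset.range (b ^ m), θ w ^ 2 := Finset.sum_nonneg fun _ _ => sq_nonneg _
    positivity
  induction p with
  | zero => simp
  | succ p ih =>
    have h := hε.norm_charFun_nodeForm_succ_sub_le (m + p) (levelCoeff b m (p + 1) θ)
    rw [signMean_mul_blockSum_levelCoeff] at h
    have hsq := sum_levelCoeff_sq (b := b) m (p + 1) θ
    have hcast : Complex.exp (-((1 - (signMean b : ℂ) ^ 2)
        * ((∑ k ∈ Finset.range (b ^ (m + p + 1)), levelCoeff b m (p + 1) θ k ^ 2 : ℝ) : ℂ) / 2))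
        = (Real.exp (-V) : ℂ) := by
      rw [hV, ← hsq, ← add_assoc]
      push_cast
      rfl
    rw [hcast] at h
    have h3 := sum_abs_levelCoeff_pow_three_le (b := b) m (p + 1) θ
    rw [← add_assoc] at h3 ⊢
    set E1 := ∫ ω, Complex.exp (nodeForm ε (m + p + 1) (levelCoeff b m (p + 1) θ) ω * Complex.I) ∂P
    set E2 := ∫ ω, Complex.exp (nodeForm ε (m + p) (levelCoeff b m p θ) ω * Complex.I) ∂P
    set E3 := ∫ ω, Complex.exp (nodeForm ε m (levelCoeff b m 0 θ) ω * Complex.I) ∂P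
    have hexp : (Real.exp (-V * ((p + 1 : ℕ) : ℝ)) : ℂ)
        = (Real.exp (-V) : ℂ) * (Real.exp (-V * p) : ℂ) := by
      rw [← Complex.ofReal_mul, ← Real.exp_add]
      push_cast
      ring_nf
    rw [hexp]
    have hsplit : E1 - (Real.exp (-V) : ℂ) * (Real.exp (-V * p) : ℂ) * E3
        = (E1 - (Real.exp (-V) : ℂ) * E2)
          + (Real.exp (-V) : ℂ) * (E2 - (Real.exp (-V * p) : ℂ) * E3) := by ring
    rw [hsplit]
    refine (norm_add_le _ _).trans ?_
    have hle : ‖(Real.exp (-V) : ℂ)‖ ≤ 1 := by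
      rw [Complex.norm_real, Real.norm_of_nonneg (Real.exp_pos _).le]
      exact Real.exp_le_one_iff.2 (by linarith)
    rw [norm_mul]
    have h4 := (mul_le_of_le_one_left (norm_nonneg _) hle).trans ih
    rw [Nat.cast_succ]
    linarith

/-- The sub-Gaussian counterpart of `IsSignCascade.norm_charFun_levelCoeff_sub_le`. -/
theorem IsSignCascade.mgf_levelCoeff_le (hε : IsSignCascade ε P) (m p : ℕ) (θ : ℕ → ℝ) :
    ∫ ω, Real.exp (nodeForm ε (m + p) (levelCoeff b m p θ) ω) ∂P
      ≤ Real.exp ((signMean b ^ (2 * m) * ∑ w ∈ Finset.range (b ^ m), θ w ^ 2) / 2 * p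
        + ∑ w ∈ Finset.range (b ^ m), signMean b ^ m * |θ w|) := by
  induction p with
  | zero =>
    have : ∀ᵐ ω ∂P, ‖Real.exp (nodeForm ε m (levelCoeff b m 0 θ) ω)‖
        ≤ Real.exp (∑ w ∈ Finset.range (b ^ m), signMean b ^ m * |θ w|) := by
      refine ae_of_all _ fun ω => ?_
      rw [Real.norm_of_nonneg (Real.exp_pos _).le]
      refine Real.exp_le_exp.2 ((le_abs_self _).trans ((hε.abs_nodeForm_le _ _ _).trans ?_))
      refine Finset.sum_le_sum fun w _ => ?_
      rw [levelCoeff_zero, abs_mul, abs_of_nonneg (pow_nonneg (signMean_nonneg b) m)]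
    have h := norm_integral_le_of_norm_le_const this
    simp only [probReal_univ, mul_one] at h
    simpa using (le_abs_self _).trans h
  | succ p ih =>
    have h := hε.mgf_nodeForm_succ_le (m + p) (levelCoeff b m (p + 1) θ)
    rw [signMean_mul_blockSum_levelCoeff, add_assoc m p 1, sum_levelCoeff_sq] at h
    refine h.trans ?_
    refine (mul_le_mul_of_nonneg_left ih (Real.exp_pos _).le).trans (le_of_eq ?_)
    rw [← Real.exp_add]
    push_cast
    ring_nf

/-- The characteristic function of the vector of the increments over the intervals of generation
`m` converges to that of a vector of independent centred Gaussian variables of variance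
`b ^ (-m)`. -/
theorem IsSignCascade.tendsto_charFun_cascadeIncr (hb : 2 ≤ b) (hε : IsSignCascade ε P) (m : ℕ)
    (θ : ℕ → ℝ) :
    Tendsto (fun n : ℕ => ∫ ω, Complex.exp ((∑ w ∈ Finset.range (b ^ m),
        θ w * cascadeIncr ε (sigmaHalf b * Real.sqrt n)⁻¹ m (n - m) w ω : ℝ) * Complex.I) ∂P)
      atTop (𝓝 (Real.exp (-((∑ w ∈ Finset.range (b ^ m), θ w ^ 2) / b ^ m / 2)) : ℂ)) := by
  have hb' : (2 : ℝ) ≤ b := by exact_mod_cast hb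
  set sg := sigmaHalf b with hsg
  have hsg2 : sg ^ 2 = 1 - signMean b ^ 2 := by
    rw [hsg, sigmaHalf, Real.sq_sqrt (div_nonneg (by linarith) (by linarith)), signMean_sq]
    field_simp
  have hsgpos : 0 < sg := by
    rw [hsg, sigmaHalf]
    exact Real.sqrt_pos.2 (div_pos (by linarith) (by linarith))
  set c : ℕ → ℝ := fun n => (sg * Real.sqrt n)⁻¹ with hc
  set S2 := ∑ w ∈ Finset.range (b ^ m), θ w ^ 2
  set S3 := ∑ w ∈ Finset.range (b ^ m), |θ w| ^ 3
  have hcn0 : ∀ n, 0 ≤ c n := fun n => by simp only [hc]; positivity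
  have hinv : Tendsto (fun n : ℕ => (Real.sqrt n)⁻¹) atTop (𝓝 0) :=
    tendsto_inv_atTop_zero.comp (Real.tendsto_sqrt_atTop.comp tendsto_natCast_atTop_atTop)
  have hc0 : Tendsto c atTop (𝓝 0) := by
    have := hinv.const_mul sg⁻¹
    rw [mul_zero] at this
    refine this.congr fun n => ?_
    simp only [hc, mul_inv]
  have hcsq : ∀ n : ℕ, 0 < n → (1 - signMean b ^ 2) * c n ^ 2 = (n : ℝ)⁻¹ := by
    intro n hn
    have hn' : (0 : ℝ) < n := by exact_mod_cast hn
    simp only [hc]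
    rw [← hsg2, inv_pow, mul_pow, Real.sq_sqrt hn'.le]
    field_simp
  have hsub : Tendsto (fun n : ℕ => ((n - m : ℕ) : ℝ) * (n : ℝ)⁻¹) atTop (𝓝 1) := by
    have h1 : Tendsto (fun n : ℕ => 1 - (m : ℝ) * (n : ℝ)⁻¹) atTop (𝓝 (1 - m * 0)) :=
      tendsto_const_nhds.sub (tendsto_inv_atTop_nhds_zero_nat.const_mul _)
    rw [mul_zero, sub_zero] at h1
    refine h1.congr' ?_
    filter_upwards [eventually_ge_atTop (m + 1)] with n hn
    have hn' : (0 : ℝ) < n := by exact_mod_cast (by omega : 0 < n)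
    rw [Nat.cast_sub (by omega)]
    field_simp
  -- the Gaussian factors accumulated over the generations `m + 1, …, n`
  have hG : Tendsto (fun n : ℕ => (Real.exp (-((1 - signMean b ^ 2)
          * (signMean b ^ (2 * m) * ∑ w ∈ Finset.range (b ^ m), (c n * θ w) ^ 2) / 2)
          * ((n - m : ℕ) : ℝ)) : ℂ)) atTop (𝓝 (Real.exp (-(S2 / b ^ m / 2)) : ℂ)) := by
    refine (Complex.continuous_ofReal.tendsto _).comp ((Real.continuous_exp.tendsto _).comp ?_)
    have h1 := hsub.const_mul (-(S2 / b ^ m / 2))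
    rw [mul_one] at h1
    refine h1.congr' ?_
    filter_upwards [eventually_ge_atTop 1] with n hn
    rw [← hcsq n hn, pow_mul, signMean_sq]
    simp only [mul_pow]
    rw [← Finset.mul_sum, inv_pow]
    ring
  -- the contribution of the first `m` generations disappears
  have hI : Tendsto (fun n : ℕ => ∫ ω, Complex.exp
        (nodeForm ε m (levelCoeff b m 0 fun w => c n * θ w) ω * Complex.I) ∂P)
      atTop (𝓝 1) := by
    have h1 : (1 : ℂ) = ∫ _ω, (1 : ℂ) ∂P := by simp
    rw [h1]
    refine tendsto_integral_of_dominated_convergence (fun _ => 1) (fun n => ?_)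
      (integrable_const _) (fun n => ?_) (ae_of_all _ fun ω => ?_)
    · have := hε.measurable_nodeForm m (levelCoeff b m 0 fun w => c n * θ w)
      exact (Complex.measurable_exp.comp
        ((Complex.measurable_ofReal.comp this).mul_const _)).aestronglyMeasurable
    · exact ae_of_all _ fun ω => (Complex.norm_exp_ofReal_mul_I _).le
    · have h2 : ∀ n, nodeForm ε m (levelCoeff b m 0 fun w => c n * θ w) ω
          = c n * nodeForm ε m (levelCoeff b m 0 θ) ω := by
        intro n
        simp only [nodeForm, levelCoeff_zero, Finset.mul_sum]
        exact Finset.sum_congr rfl fun _ _ => by ring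
      have h3 := hc0.mul_const (nodeForm ε m (levelCoeff b m 0 θ) ω)
      rw [zero_mul] at h3
      have h4 : Continuous fun x : ℝ => Complex.exp (x * Complex.I) := by fun_prop
      have h5 := (h4.tendsto 0).comp h3
      simp only [h2]
      simpa [Function.comp_def] using h5
  have hprod := hG.mul hI
  rw [mul_one] at hprod
  -- the accumulated third order errors are of order `n * n ^ (-3 / 2)`
  have hbound : Tendsto (fun n : ℕ => 16 * S3 * (((n - m : ℕ) : ℝ) * c n ^ 3)) atTop (𝓝 0) := by
    have h1 : Tendsto (fun n : ℕ => ((n - m : ℕ) : ℝ) * (n : ℝ)⁻¹ * (sg⁻¹ ^ 2 * c n)) atTop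
        (𝓝 (1 * (sg⁻¹ ^ 2 * 0))) := hsub.mul (hc0.const_mul _)
    have h2 := h1.const_mul (16 * S3)
    simp only [mul_zero] at h2
    refine h2.congr' ?_
    filter_upwards [eventually_ge_atTop 1] with n hn
    rw [← hcsq n hn, ← hsg2]
    field_simp
  refine (tendsto_iff_norm_sub_tendsto_zero (E := ℂ)).2 ?_
  have hdiff := tendsto_iff_norm_sub_tendsto_zero.1 hprod
  have hsum := hbound.add hdiff
  rw [add_zero] at hsum
  refine squeeze_zero' (Eventually.of_forall fun _ => norm_nonneg _) ?_ hsum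
  filter_upwards [eventually_ge_atTop m] with n hn
  have h := hε.norm_charFun_levelCoeff_sub_le m (n - m) (fun w => c n * θ w)
  have hS : ∑ w ∈ Finset.range (b ^ m), |c n * θ w| ^ 3 = c n ^ 3 * S3 := by
    rw [Finset.mul_sum]
    refine Finset.sum_congr rfl fun w _ => ?_
    rw [abs_mul, mul_pow, abs_of_nonneg (hcn0 n)]
  rw [hS] at h
  simp_rw [sum_mul_cascadeIncr]
  refine (norm_sub_le_norm_sub_add_norm_sub _ _ _).trans (add_le_add_left ?_ _)
  refine h.trans (le_of_eq ?_)
  ring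

theorem pow_four_le_exp_add_exp (x : ℝ) : x ^ 4 ≤ 24 * (Real.exp x + Real.exp (-x)) := by
  have h := Real.pow_div_factorial_le_exp |x| (abs_nonneg x) 4
  have h4 : |x| ^ 4 = x ^ 4 := by rw [← abs_pow, abs_of_nonneg (by positivity)]
  rw [h4] at h
  norm_num [Nat.factorial] at h
  have h1 := Real.exp_pos x
  have h2 := Real.exp_pos (-x)
  rcases abs_cases x with ⟨hx, _⟩ | ⟨hx, _⟩ <;> rw [hx] at h <;> linarith

theorem IsSignCascade.mgf_cascadeIncr_le (hε : IsSignCascade ε P) (c l : ℝ) {m p w : ℕ}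
    (hw : w < b ^ m) :
    ∫ ω, Real.exp (l * cascadeIncr ε c m p w ω) ∂P
      ≤ Real.exp (signMean b ^ (2 * m) * (c * l) ^ 2 / 2 * p + signMean b ^ m * |c * l|) := by
  have hw' := Finset.mem_range.2 hw
  have h := hε.mgf_levelCoeff_le m p (fun k => c * (if k = w then l else 0))
  simp_rw [← sum_mul_cascadeIncr c m p fun k => if k = w then l else 0] at h
  have e1 : ∑ k ∈ Finset.range (b ^ m), (c * if k = w then l else 0) ^ 2 = (c * l) ^ 2 := by
    simp [ite_pow, mul_pow, hw]
  have e2 : ∑ k ∈ Finset.range (b ^ m), signMean b ^ m * |c * if k = w then l else 0|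
      = signMean b ^ m * |c * l| := by
    rw [Finset.sum_eq_single w (fun k _ hk => by simp [hk]) (fun h => absurd hw' h), if_pos rfl]
  rw [e1, e2] at h
  simpa [hw] using h

/-- The fourth moments of the increments over the intervals of generation `m` are of order
`b ^ (-2 m)`, uniformly in the generation of the path. -/
theorem IsSignCascade.integral_cascadeIncr_pow_four_le (hb : 2 ≤ b) (hε : IsSignCascade ε P)
    {m p w : ℕ} (hmp : 0 < m + p) (hw : w < b ^ m) :
    ∫ ω, cascadeIncr ε (sigmaHalf b * Real.sqrt (m + p : ℕ))⁻¹ m p w ω ^ 4 ∂P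
      ≤ 48 * Real.exp 3 * (((b : ℝ) ^ m) ^ 2)⁻¹ := by
  have hb' : (2 : ℝ) ≤ b := by exact_mod_cast hb
  have hn : (1 : ℝ) ≤ (m + p : ℕ) := by exact_mod_cast hmp
  set c := (sigmaHalf b * Real.sqrt (m + p : ℕ))⁻¹ with hc
  have hc0 : 0 ≤ c := by rw [hc, sigmaHalf]; positivity
  have hcp : c ^ 2 * (m + p : ℕ) ≤ 2 := by
    rw [hc, inv_pow, mul_pow, sigmaHalf, Real.sq_sqrt (div_nonneg (by linarith) (by linarith)),
      Real.sq_sqrt (by linarith), mul_inv, mul_assoc,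
      inv_mul_cancel₀ (by linarith), mul_one, inv_div, div_le_iff₀ (by linarith)]
    linarith
  have hc2 : c ^ 2 ≤ 2 := by nlinarith [sq_nonneg c]
  have hc2' : c ≤ 2 := by nlinarith
  have hp : c ^ 2 * p ≤ 2 := by
    refine le_trans ?_ hcp
    gcongr
    omega
  have hβ : 0 < signMean b := by
    have := signMean_nonneg b
    refine lt_of_le_of_ne this fun h => ?_
    have := signMean_sq b
    rw [← h] at this
    have h' : 0 < (b : ℝ)⁻¹ := by positivity
    rw [← this] at h'
    norm_num at h'
  have hβm : 0 < signMean b ^ m := pow_pos hβ m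
  -- the inverse of the order of magnitude `b ^ (-m / 2)` of the increments
  set l := (signMean b ^ m)⁻¹ with hl
  have hl0 : 0 < l := inv_pos.2 hβm
  have hlβ : signMean b ^ m * l = 1 := mul_inv_cancel₀ hβm.ne'
  have hexp : ∀ x : ℝ, |x| = l →
      ∫ ω, Real.exp (x * cascadeIncr ε c m p w ω) ∂P ≤ Real.exp 3 := by
    intro x hx
    refine (hε.mgf_cascadeIncr_le c x hw).trans (Real.exp_le_exp.2 ?_)
    have e1 : signMean b ^ (2 * m) * (c * x) ^ 2 / 2 * p = c ^ 2 * p / 2 := by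
      rw [mul_pow, ← sq_abs x, hx]
      calc _ = (signMean b ^ m * l) ^ 2 * (c ^ 2 * p / 2) := by ring
        _ = _ := by rw [hlβ]; ring
    have e2 : signMean b ^ m * |c * x| = c := by
      rw [abs_mul, hx, abs_of_nonneg hc0]
      calc _ = (signMean b ^ m * l) * c := by ring
        _ = _ := by rw [hlβ]; ring
    rw [e1, e2]
    linarith
  obtain ⟨C, hC⟩ := hε.exists_abs_cascadeIncr_le c m p w
  have hm := hε.measurable_cascadeIncr c m p w
  have hintexp : ∀ x : ℝ, Integrable (fun ω => Real.exp (x * cascadeIncr ε c m p w ω)) P := by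
    intro x
    refine Integrable.of_bound (C := Real.exp (|x| * C)) (hm.const_mul x).exp.aestronglyMeasurable
      (ae_of_all _ fun ω => ?_)
    rw [Real.norm_of_nonneg (Real.exp_pos _).le]
    refine Real.exp_le_exp.2 ((le_abs_self _).trans ?_)
    rw [abs_mul]
    exact mul_le_mul_of_nonneg_left (hC ω) (abs_nonneg x)
  have hpow : ((b : ℝ) ^ m) ^ 2 = l ^ 4 := by
    have : l ^ 2 = (b : ℝ) ^ m := by
      rw [hl, inv_pow, ← pow_mul, mul_comm, pow_mul, signMean_sq, inv_pow, inv_inv]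
    rw [← this]; ring
  have hmain : ∫ ω, (l * cascadeIncr ε c m p w ω) ^ 4 ∂P ≤ 48 * Real.exp 3 := by
    calc ∫ ω, (l * cascadeIncr ε c m p w ω) ^ 4 ∂P
        ≤ ∫ ω, 24 * (Real.exp (l * cascadeIncr ε c m p w ω)
            + Real.exp (-l * cascadeIncr ε c m p w ω)) ∂P := by
          refine integral_mono_of_nonneg (ae_of_all _ fun ω => by positivity)
            (((hintexp l).add (hintexp (-l))).const_mul 24) (ae_of_all _ fun ω => ?_)
          simpa using pow_four_le_exp_add_exp (l * cascadeIncr ε c m p w ω)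
      _ ≤ 48 * Real.exp 3 := by
          rw [integral_const_mul, integral_add (hintexp l) (hintexp (-l))]
          have h1 := hexp l (abs_of_pos hl0)
          have h2 := hexp (-l) (by rw [abs_neg, abs_of_pos hl0])
          linarith
  simp_rw [mul_pow] at hmain
  rw [integral_const_mul] at hmain
  rw [hpow, ← div_eq_mul_inv, le_div_iff₀ (by positivity), mul_comm]
  exact hmain

end

end

noncomputable section

/-! ### Chaining -/

theorem measurable_polyline {Ω : Type*} [MeasurableSpace Ω] (N : ℕ) {d : ℕ → Ω → ℝ}
    (hd : ∀ k, Measurable (d k)) : Measurable fun ω => polyline N fun k => d k ω := by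
  have hc : Continuous fun v : Fin N → ℝ => ∑ k : Fin N, v k • ramp N k := by fun_prop
  have h := hc.measurable.comp (measurable_pi_lambda _ fun k : Fin N => hd k)
  convert h using 1
  funext ω
  simp only [Function.comp, polyline]
  rw [Finset.sum_range]

/-- The ratio `b ^ (-1 / 4)` of the geometric bounds obtained by chaining. -/
def chainRate (b : ℕ) : ℝ := Real.sqrt (signMean b)

theorem chainRate_pow_four (b : ℕ) : chainRate b ^ 4 = (b : ℝ)⁻¹ := by
  rw [show chainRate b ^ 4 = (chainRate b ^ 2) ^ 2 by ring, chainRate,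
    Real.sq_sqrt (signMean_nonneg b), signMean_sq]

theorem chainRate_pos (b : ℕ) [NeZero b] : 0 < chainRate b := by
  have hb : 0 < b := NeZero.pos b
  rw [chainRate, signMean]
  positivity

theorem chainRate_lt_one {b : ℕ} (hb : 2 ≤ b) : chainRate b < 1 := by
  have hb' : (2 : ℝ) ≤ b := by exact_mod_cast hb
  by_contra! h
  have h1 := one_le_pow₀ h (n := 4)
  rw [chainRate_pow_four] at h1
  have h2 := inv_lt_one_of_one_lt₀ (by linarith : (1 : ℝ) < b)
  linarith

theorem abs_le_add_pow_four {l : ℝ} (hl : 0 < l) (x : ℝ) : |x| ≤ l + (l ^ 3)⁻¹ * x ^ 4 := by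
  rw [← Even.pow_abs (by decide) x]
  rcases le_or_gt |x| l with h | h
  · have : 0 ≤ (l ^ 3)⁻¹ * |x| ^ 4 := by positivity
    linarith
  · have h3 : l ^ 3 ≤ |x| ^ 3 := pow_le_pow_left₀ hl.le h.le 3
    have : |x| ≤ (l ^ 3)⁻¹ * |x| ^ 4 := by
      rw [← div_eq_inv_mul, le_div_iff₀ (by positivity)]
      nlinarith [abs_nonneg x]
    linarith

/-- If the increments of a random path over the intervals of generation `r + 1` have fourth moments
of order `b ^ (-2 (r + 1))`, then replacing the grid of generation `r + 1` by that of generation `r`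
moves the path by `O(b ^ (-(r + 1) / 4))` in expectation. -/
theorem integral_norm_polyline_sub_polyline_blockSum_le {Ω : Type*} [MeasurableSpace Ω]
    {P : Measure Ω} [IsProbabilityMeasure P] {b : ℕ} [NeZero b] {K : ℝ} (r : ℕ) {d : ℕ → Ω → ℝ}
    (hd : ∀ k, Measurable (d k)) (hint : ∀ k < b ^ (r + 1), Integrable (fun ω => d k ω ^ 4) P)
    (hK : ∀ k < b ^ (r + 1), ∫ ω, d k ω ^ 4 ∂P ≤ K * (((b : ℝ) ^ (r + 1)) ^ 2)⁻¹) :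
    Integrable (fun ω => ‖polyline (b ^ (r + 1)) (fun k => d k ω)
        - polyline (b ^ r) (blockSum b fun k => d k ω)‖) P ∧
      ∫ ω, ‖polyline (b ^ (r + 1)) (fun k => d k ω)
        - polyline (b ^ r) (blockSum b fun k => d k ω)‖ ∂P
      ≤ b * (1 + K) * chainRate b ^ (r + 1) := by
  set l := chainRate b ^ (r + 1) with hl
  have hl0 : 0 < l := pow_pos (chainRate_pos b) _
  have hl4 : l ^ 4 = ((b : ℝ) ^ (r + 1))⁻¹ := by
    rw [hl, ← pow_mul, mul_comm, pow_mul, chainRate_pow_four, inv_pow]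
  have hbpos : (0 : ℝ) < (b : ℝ) ^ (r + 1) := by
    have := NeZero.pos b
    positivity
  -- `x ≤ l + x ^ 4 / l ^ 3`, where `l` balances the two terms after summation over the grid
  have hpt : ∀ ω, ‖polyline (b ^ (r + 1)) (fun k => d k ω)
        - polyline (b ^ r) (blockSum b fun k => d k ω)‖
      ≤ b * (l + (l ^ 3)⁻¹ * ∑ k ∈ Finset.range (b ^ (r + 1)), d k ω ^ 4) := by
    intro ω
    have hS0 : 0 ≤ ∑ k ∈ Finset.range (b ^ (r + 1)), d k ω ^ 4 :=
      Finset.sum_nonneg fun _ _ => by positivity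
    rw [pow_succ b r]
    refine norm_polyline_sub_polyline_blockSum_le (Nat.pow_pos (NeZero.pos b)) (by positivity) ?_
    intro k hk
    rw [← pow_succ] at hk
    refine (abs_le_add_pow_four hl0 _).trans ?_
    gcongr
    exact Finset.single_le_sum (f := fun k => d k ω ^ 4) (fun _ _ => by positivity)
      (Finset.mem_range.2 hk)
  have hint' : Integrable (fun ω => b * (l + (l ^ 3)⁻¹
      * ∑ k ∈ Finset.range (b ^ (r + 1)), d k ω ^ 4)) P :=
    ((integrable_const _).add
      ((integrable_finsetSum _ fun k hk => hint k (Finset.mem_range.1 hk)).const_mul _)).const_mul _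
  have hmeas : Measurable fun ω => ‖polyline (b ^ (r + 1)) (fun k => d k ω)
        - polyline (b ^ r) (blockSum b fun k => d k ω)‖ := by
    have h2 := measurable_polyline (b ^ r) (d := fun k ω => blockSum b (fun k => d k ω) k)
      fun k => Finset.measurable_sum _ fun _ _ => hd _
    exact ((measurable_polyline _ hd).sub h2).norm
  have hInt : Integrable (fun ω => ‖polyline (b ^ (r + 1)) (fun k => d k ω)
        - polyline (b ^ r) (blockSum b fun k => d k ω)‖) P := by
    refine hint'.mono' hmeas.aestronglyMeasurable (ae_of_all _ fun ω => ?_)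
    rw [norm_norm]
    exact hpt ω
  refine ⟨hInt, (integral_mono hInt hint' hpt).trans ?_⟩
  have hs : ∑ k ∈ Finset.range (b ^ (r + 1)), ∫ ω, d k ω ^ 4 ∂P ≤ K * l ^ 4 := by
    refine (Finset.sum_le_sum fun k hk => hK k (Finset.mem_range.1 hk)).trans (le_of_eq ?_)
    rw [Finset.sum_const, Finset.card_range, nsmul_eq_mul, hl4]
    push_cast
    field_simp
  rw [integral_const_mul, integral_add (integrable_const _)
    ((integrable_finsetSum _ fun k hk => hint k (Finset.mem_range.1 hk)).const_mul _),
    integral_const_mul, integral_finsetSum _ fun k hk => hint k (Finset.mem_range.1 hk)]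
  simp only [integral_const, probReal_univ, one_smul]
  rw [mul_assoc]
  refine mul_le_mul_of_nonneg_left ?_ (Nat.cast_nonneg b)
  have h5 : (l ^ 3)⁻¹ * (K * l ^ 4) = K * l := by field_simp
  have h6 := mul_le_mul_of_nonneg_left hs (by positivity : 0 ≤ (l ^ 3)⁻¹)
  linarith

/-- The normalised cascade path of generation `n` and its interpolation on the grid of a generation
`m ≤ n` are close in expectation, uniformly in `n`. -/
theorem IsSignCascade.integral_norm_sub_polyline_le {b : ℕ} [NeZero b] {Ω : Type*}
    [MeasurableSpace Ω] {P : Measure Ω} [IsProbabilityMeasure P] {ε : List (Fin b) → Ω → ℝ}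
    (hb : 2 ≤ b) (hε : IsSignCascade ε P) {m n : ℕ} (hmn : m ≤ n) :
    Integrable (fun ω =>
        ‖polyline (b ^ n) (fun w => cascadeIncr ε (sigmaHalf b * Real.sqrt n)⁻¹ n 0 w ω)
        - polyline (b ^ m) (fun w => cascadeIncr ε (sigmaHalf b * Real.sqrt n)⁻¹ m (n - m) w ω)‖)
        P ∧
      ∫ ω, ‖polyline (b ^ n) (fun w => cascadeIncr ε (sigmaHalf b * Real.sqrt n)⁻¹ n 0 w ω)
        - polyline (b ^ m) (fun w => cascadeIncr ε (sigmaHalf b * Real.sqrt n)⁻¹ m (n - m) w ω)‖ ∂P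
      ≤ b * (1 + 48 * Real.exp 3) * (chainRate b ^ m / (1 - chainRate b)) := by
  set c := (sigmaHalf b * Real.sqrt n)⁻¹ with hc
  set X : ℕ → Ω → C(I, ℝ) := fun r ω => polyline (b ^ r) fun w => cascadeIncr ε c r (n - r) w ω
    with hX
  have hXm : ∀ r, Measurable (X r) := fun r =>
    measurable_polyline _ fun w => hε.measurable_cascadeIncr c r (n - r) w
  have hstep : ∀ r, r < n → Integrable (fun ω => ‖X (r + 1) ω - X r ω‖) P ∧
      ∫ ω, ‖X (r + 1) ω - X r ω‖ ∂P ≤ b * (1 + 48 * Real.exp 3) * chainRate b ^ (r + 1) := by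
    intro r hr
    have h := integral_norm_polyline_sub_polyline_blockSum_le (P := P) (b := b)
      (K := 48 * Real.exp 3) r
      (d := fun w ω => cascadeIncr ε c (r + 1) (n - (r + 1)) w ω)
      (fun w => hε.measurable_cascadeIncr _ _ _ w) (fun w _ => ?_) (fun w hw => ?_)
    · have e : ∀ ω, X r ω = polyline (b ^ r)
          (blockSum b fun w => cascadeIncr ε c (r + 1) (n - (r + 1)) w ω) := by
        intro ω
        rw [← cascadeIncr_refine, hX, show n - (r + 1) + 1 = n - r by omega]
      simp only [e]
      exact h
    · obtain ⟨C, hC⟩ := hε.exists_abs_cascadeIncr_le c (r + 1) (n - (r + 1)) w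
      refine Integrable.of_bound (C := C ^ 4)
        ((hε.measurable_cascadeIncr _ _ _ w).pow_const 4).aestronglyMeasurable
        (ae_of_all _ fun ω => ?_)
      rw [norm_pow]
      exact pow_le_pow_left₀ (norm_nonneg _) (hC ω) 4
    · have h2 := hε.integral_cascadeIncr_pow_four_le hb (p := n - (r + 1)) (by omega) hw
      rwa [show r + 1 + (n - (r + 1)) = n by omega, ← hc] at h2
  have hXn : ∀ ω, polyline (b ^ n) (fun w => cascadeIncr ε c n 0 w ω) = X n ω := by
    intro ω
    simp only [hX, Nat.sub_self]
  simp only [hXn]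
  change Integrable (fun ω => ‖X n ω - X m ω‖) P ∧ ∫ ω, ‖X n ω - X m ω‖ ∂P ≤ _
  have hpt : ∀ ω, ‖X n ω - X m ω‖ ≤ ∑ r ∈ Finset.Ico m n, ‖X (r + 1) ω - X r ω‖ := by
    intro ω
    have h := dist_le_Ico_sum_dist (fun r => X r ω) hmn
    simp only [dist_eq_norm] at h
    rw [norm_sub_rev]
    refine h.trans (le_of_eq (Finset.sum_congr rfl fun r _ => norm_sub_rev _ _))
  have hsum : Integrable (fun ω => ∑ r ∈ Finset.Ico m n, ‖X (r + 1) ω - X r ω‖) P :=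
    integrable_finsetSum _ fun r hr => (hstep r (Finset.mem_Ico.1 hr).2).1
  have hInt : Integrable (fun ω => ‖X n ω - X m ω‖) P := by
    refine hsum.mono' ((hXm n).sub (hXm m)).norm.aestronglyMeasurable (ae_of_all _ fun ω => ?_)
    rw [norm_norm]
    exact hpt ω
  refine ⟨hInt, (integral_mono hInt hsum hpt).trans ?_⟩
  rw [integral_finsetSum _ fun r hr => (hstep r (Finset.mem_Ico.1 hr).2).1]
  refine (Finset.sum_le_sum fun r hr => (hstep r (Finset.mem_Ico.1 hr).2).2).trans ?_
  rw [← Finset.mul_sum]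
  refine mul_le_mul_of_nonneg_left ?_ (by positivity)
  have h0 := (chainRate_pos b).le
  have h1 := chainRate_lt_one hb
  refine le_trans (Finset.sum_le_sum fun r _ => pow_le_pow_of_le_one h0 h1.le (Nat.le_succ r)) ?_
  exact geom_sum_Ico_le_of_lt_one h0 h1

end

noncomputable section

/-! ### Convergence to Wiener measure -/

/-- The polygonal path on the grid of mesh `1 / N`, as a function of the vector of its
increments. -/
def polylineVec (N : ℕ) (v : EuclideanSpace ℝ (Fin N)) : C(I, ℝ) := ∑ k : Fin N, v k • ramp N k

theorem continuous_polylineVec (N : ℕ) : Continuous (polylineVec N) := by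
  unfold polylineVec
  fun_prop

theorem polylineVec_toLp (N : ℕ) (d : ℕ → ℝ) :
    polylineVec N (WithLp.toLp 2 fun k : Fin N => d k) = polyline N d := by
  simp only [polylineVec, polyline, Finset.sum_range]

/-- The increments of a path over the intervals of length `1 / N`. -/
def gridIncr (N : ℕ) (f : C(I, ℝ)) (k : ℕ) : ℝ := f (gridPoint N (k + 1)) - f (gridPoint N k)

theorem measurable_gridIncr (N k : ℕ) : Measurable fun f : C(I, ℝ) => gridIncr N f k := by
  unfold gridIncr
  exact ((continuous_eval_const _).sub (continuous_eval_const _)).measurable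

theorem measurable_toLp_pi {Ω : Type*} [MeasurableSpace Ω] {N : ℕ} {X : Fin N → Ω → ℝ}
    (hX : ∀ i, Measurable (X i)) :
    Measurable fun ω => (WithLp.toLp 2 fun i => X i ω : EuclideanSpace ℝ (Fin N)) :=
  (MeasurableEquiv.toLp 2 (Fin N → ℝ)).measurable.comp (measurable_pi_lambda _ hX)

theorem charFun_map_toLp {Ω : Type*} [MeasurableSpace Ω] {P : Measure Ω} {N : ℕ}
    {X : Fin N → Ω → ℝ} (hX : ∀ i, Measurable (X i)) (t : EuclideanSpace ℝ (Fin N)) :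
    charFun (P.map fun ω => (WithLp.toLp 2 fun i => X i ω : EuclideanSpace ℝ (Fin N))) t
      = ∫ ω, Complex.exp ((∑ i, t i * X i ω : ℝ) * Complex.I) ∂P := by
  have hc : Continuous fun x : EuclideanSpace ℝ (Fin N) =>
      Complex.exp ((inner ℝ x t : ℝ) * Complex.I) := by fun_prop
  rw [charFun_apply, integral_map (measurable_toLp_pi hX).aemeasurable hc.aestronglyMeasurable]
  simp only [PiLp.inner_apply]
  rfl

/-- Under Wiener measure the increments over the intervals of length `1 / N` are independent
Gaussian variables of variance `1 / N`. -/
theorem IsWienerMeasure.charFun_gridIncr {W : Measure C(I, ℝ)} [IsProbabilityMeasure W]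
    (hW : IsWienerMeasure W) {N : ℕ} (hN : 0 < N) (t : EuclideanSpace ℝ (Fin N)) :
    charFun (W.map fun f => (WithLp.toLp 2 fun i : Fin N => gridIncr N f i :
        EuclideanSpace ℝ (Fin N))) t
      = Real.exp (-((∑ i, t i ^ 2) / N / 2)) := by
  have hind : iIndepFun (fun (i : Fin N) f => gridIncr N f i) W := by
    have h := hW.indep_increments N (fun i => gridPoint N i)
      fun i j hij => gridPoint_mono N (Fin.val_le_of_le hij)
    simpa [gridIncr] using h
  have h := (iIndepFun_iff_charFun_pi (P := W) (X := fun (i : Fin N) f => gridIncr N f i)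
    (fun i => (measurable_gridIncr N i).aemeasurable)).1 hind t
  refine h.trans ?_
  have hone : ∀ i : Fin N, charFun (W.map fun f => gridIncr N f i) (t i)
      = Complex.exp (-(t i ^ 2 / N / 2)) := by
    intro i
    have hlaw := (hW.gaussian_increments _ _ (gridPoint_mono N (Nat.le_succ (i : ℕ)))).map_eq
    have hval : Real.toNNReal ((gridPoint N (i + 1) : ℝ) - gridPoint N i)
        = Real.toNNReal (1 / N) := by
      rw [coe_gridPoint i.2, coe_gridPoint i.2.le]
      congr 1
      push_cast
      ring
    change charFun (W.map fun f : C(I, ℝ) => f (gridPoint N (i + 1)) - f (gridPoint N i)) (t i) = _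
    rw [Nat.succ_eq_add_one, hval] at hlaw
    rw [hlaw, charFun_gaussianReal, Real.coe_toNNReal _ (by positivity)]
    congr 1
    push_cast
    ring
  rw [Finset.prod_congr rfl fun i _ => hone i, ← Complex.exp_sum]
  push_cast
  congr 1
  rw [Finset.sum_neg_distrib, Finset.sum_div, Finset.sum_div]

theorem IsWienerMeasure.tendsto_integral_polyline_gridIncr {b : ℕ} (hb : 2 ≤ b)
    {W : Measure C(I, ℝ)} [IsProbabilityMeasure W] (hW : IsWienerMeasure W)
    {F : C(I, ℝ) → ℝ} (hF : Continuous F) {C : ℝ} (hC : ∀ x y, dist (F x) (F y) ≤ C) :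
    Tendsto (fun m : ℕ => ∫ f, F (polyline (b ^ m) (gridIncr (b ^ m) f)) ∂W) atTop
      (𝓝 (∫ f, F f ∂W)) := by
  refine tendsto_integral_of_dominated_convergence (fun _ => C + |F 0|) (fun m => ?_)
    (integrable_const _) (fun m => ae_of_all _ fun f => ?_) ?_
  · exact (hF.measurable.comp (measurable_polyline (b ^ m)
      fun k => measurable_gridIncr (b ^ m) k)).aestronglyMeasurable
  · have h := hC (polyline (b ^ m) (gridIncr (b ^ m) f)) 0
    rw [Real.dist_eq] at h
    rw [Real.norm_eq_abs]
    have := abs_sub_abs_le_abs_sub (F (polyline (b ^ m) (gridIncr (b ^ m) f))) (F 0)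
    linarith
  · filter_upwards [hW.start_zero] with f hf
    exact (hF.tendsto f).comp ((tendsto_polyline_increments f hf).comp
      (tendsto_pow_atTop_atTop_of_one_lt (by omega)))

variable {b : ℕ} [NeZero b] {Ω : Type*} [MeasurableSpace Ω] {P : Measure Ω}
  [IsProbabilityMeasure P] {ε : List (Fin b) → Ω → ℝ}

/-- The interpolations of the normalised cascade paths on a fixed grid converge in distribution to
the interpolation of Brownian motion. -/
theorem IsSignCascade.tendsto_integral_polyline (hb : 2 ≤ b) (hε : IsSignCascade ε P)
    {W : Measure C(I, ℝ)} [IsProbabilityMeasure W] (hW : IsWienerMeasure W) (m : ℕ)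
    {F : C(I, ℝ) → ℝ} (hF : Continuous F) {C : ℝ} (hC : ∀ x y, dist (F x) (F y) ≤ C) :
    Tendsto (fun n : ℕ => ∫ ω, F (polyline (b ^ m) fun w =>
        cascadeIncr ε (sigmaHalf b * Real.sqrt n)⁻¹ m (n - m) w ω) ∂P)
      atTop (𝓝 (∫ f, F (polyline (b ^ m) (gridIncr (b ^ m) f)) ∂W)) := by
  have hN : 0 < b ^ m := Nat.pow_pos (NeZero.pos b)
  set D : ℕ → Ω → EuclideanSpace ℝ (Fin (b ^ m)) := fun n ω => WithLp.toLp 2 fun w =>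
    cascadeIncr ε (sigmaHalf b * Real.sqrt n)⁻¹ m (n - m) w ω with hD
  set G : C(I, ℝ) → EuclideanSpace ℝ (Fin (b ^ m)) := fun f => WithLp.toLp 2 fun w =>
    gridIncr (b ^ m) f w with hG
  have hDm : ∀ n, Measurable (D n) := fun n =>
    measurable_toLp_pi fun w => hε.measurable_cascadeIncr _ _ _ _
  have hGm : Measurable G := measurable_toLp_pi fun w => measurable_gridIncr _ _
  let μ : ℕ → ProbabilityMeasure (EuclideanSpace ℝ (Fin (b ^ m))) := fun n =>
    ⟨P.map (D n), Measure.isProbabilityMeasure_map (hDm n).aemeasurable⟩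
  let μ₀ : ProbabilityMeasure (EuclideanSpace ℝ (Fin (b ^ m))) :=
    ⟨W.map G, Measure.isProbabilityMeasure_map hGm.aemeasurable⟩
  have hconv : Tendsto μ atTop (𝓝 μ₀) := by
    refine ProbabilityMeasure.tendsto_of_tendsto_charFun fun t => ?_
    change Tendsto (fun n => charFun (P.map (D n)) t) atTop (𝓝 (charFun (W.map G) t))
    rw [hG, hW.charFun_gridIncr hN]
    have h := hε.tendsto_charFun_cascadeIncr hb m
      (fun k => if h : k < b ^ m then t ⟨k, h⟩ else 0)
    simp only [Finset.sum_range, Fin.is_lt, dif_pos, Fin.eta] at h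
    have e : ∀ n, charFun (P.map (D n)) t = ∫ ω, Complex.exp ((∑ i, t i *
        cascadeIncr ε (sigmaHalf b * Real.sqrt n)⁻¹ m (n - m) i ω : ℝ) * Complex.I) ∂P :=
      fun n => charFun_map_toLp (fun w => hε.measurable_cascadeIncr _ _ _ _) t
    simp only [e]
    push_cast at h ⊢
    exact h
  have hFc : Continuous fun v => F (polylineVec (b ^ m) v) :=
    hF.comp (continuous_polylineVec _)
  let Φ : BoundedContinuousFunction (EuclideanSpace ℝ (Fin (b ^ m))) ℝ :=
    BoundedContinuousFunction.mkOfBound ⟨_, hFc⟩ C fun x y => hC _ _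
  have h := (ProbabilityMeasure.tendsto_iff_forall_integral_tendsto.1 hconv) Φ
  change Tendsto (fun n => ∫ v, F (polylineVec (b ^ m) v) ∂(P.map (D n))) atTop
    (𝓝 (∫ v, F (polylineVec (b ^ m) v) ∂(W.map G))) at h
  rw [integral_map hGm.aemeasurable hFc.aestronglyMeasurable] at h
  simp only [fun n => integral_map (hDm n).aemeasurable
    (hFc.aestronglyMeasurable (μ := P.map (D n)))] at h
  simp only [hD, hG] at h
  simp only [fun (n : ℕ) ω => polylineVec_toLp (b ^ m) fun w =>
    cascadeIncr ε (sigmaHalf b * Real.sqrt n)⁻¹ m (n - m) w ω, polylineVec_toLp] at h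
  exact h

theorem integrable_comp_of_dist_le {E : Type*} [MeasurableSpace E] {X : Ω → E} {F : E → ℝ}
    (hF : Measurable F) (hX : Measurable X) {C : ℝ} (hC : ∀ x y, dist (F x) (F y) ≤ C) :
    Integrable (fun ω => F (X ω)) P := by
  have := nonempty_of_isProbabilityMeasure P
  obtain ⟨ω₀⟩ := this
  refine Integrable.of_bound (C := C + |F (X ω₀)|) (hF.comp hX).aestronglyMeasurable
    (ae_of_all _ fun ω => ?_)
  have h := hC (X ω) (X ω₀)
  rw [Real.dist_eq] at h
  rw [Real.norm_eq_abs]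
  have := abs_sub_abs_le_abs_sub (F (X ω)) (F (X ω₀))
  linarith

/-- Convergence to Wiener measure for weights that are signs everywhere. Both the cascade paths and
Brownian motion are approximated, uniformly in `n`, by their interpolations on a fixed grid, and
these interpolations converge in distribution. -/
theorem IsSignCascade.tendstoInDistribution (hb : 2 ≤ b) (hε : IsSignCascade ε P)
    (W : ProbabilityMeasure C(I, ℝ)) (hW : IsWienerMeasure (W : Measure C(I, ℝ))) :
    TendstoInDistribution
      (fun (n : ℕ) (ω : Ω) =>
        (sigmaHalf b * Real.sqrt n)⁻¹ • cascadePath b (1 / 2) (fun w => ε w ω) n)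
      atTop (id : C(I, ℝ) → C(I, ℝ)) (fun _ => P) (W : Measure C(I, ℝ)) := by
  simp_rw [smul_cascadePath_eq_polyline]
  have hXm : ∀ n : ℕ, Measurable fun ω => polyline (b ^ n) fun w =>
      cascadeIncr ε (sigmaHalf b * Real.sqrt n)⁻¹ n 0 w ω := fun n =>
    measurable_polyline _ fun w => hε.measurable_cascadeIncr _ _ _ w
  refine ⟨fun n => (hXm n).aemeasurable, aemeasurable_id, ?_⟩
  refine tendsto_iff_forall_lipschitz_integral_tendsto.2 ?_
  rintro F ⟨C, hC⟩ ⟨L, hL⟩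
  have hF : Continuous F := hL.continuous
  simp only [ProbabilityMeasure.coe_mk, Measure.map_id]
  simp only [fun (n : ℕ) => integral_map (hXm n).aemeasurable
    (hF.aestronglyMeasurable (μ := P.map _))]
  set A : ℝ := L * (b * (1 + 48 * Real.exp 3)) / (1 - chainRate b) with hA
  have hρ0 := chainRate_pos b
  have hρ1 := chainRate_lt_one hb
  have hbound : ∀ m n : ℕ, m ≤ n → |∫ ω, F (polyline (b ^ n) fun w =>
      cascadeIncr ε (sigmaHalf b * Real.sqrt n)⁻¹ n 0 w ω) ∂P - ∫ ω, F (polyline (b ^ m) fun w =>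
        cascadeIncr ε (sigmaHalf b * Real.sqrt n)⁻¹ m (n - m) w ω) ∂P|
      ≤ A * chainRate b ^ m := by
    intro m n hmn
    have hYm : Measurable fun ω => polyline (b ^ m) fun w =>
        cascadeIncr ε (sigmaHalf b * Real.sqrt n)⁻¹ m (n - m) w ω :=
      measurable_polyline _ fun w => hε.measurable_cascadeIncr _ _ _ w
    obtain ⟨hi, hle⟩ := hε.integral_norm_sub_polyline_le hb hmn
    rw [← integral_sub (integrable_comp_of_dist_le hF.measurable (hXm n) hC)
      (integrable_comp_of_dist_le hF.measurable hYm hC), ← Real.norm_eq_abs]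
    refine (norm_integral_le_of_norm_le (hi.const_mul (L : ℝ)) (ae_of_all _ fun ω => ?_)).trans ?_
    · rw [← dist_eq_norm, ← dist_eq_norm]
      exact hL.dist_le_mul _ _
    · rw [integral_const_mul]
      refine (mul_le_mul_of_nonneg_left hle L.coe_nonneg).trans (le_of_eq ?_)
      rw [hA]
      ring
  rw [Metric.tendsto_atTop]
  intro δ hδ
  have h1 : Tendsto (fun m : ℕ => A * chainRate b ^ m) atTop (𝓝 0) := by
    simpa using (tendsto_pow_atTop_nhds_zero_of_lt_one hρ0.le hρ1).const_mul A
  have h2 := hW.tendsto_integral_polyline_gridIncr hb hF hC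
  obtain ⟨m, hm1, hm2⟩ := ((h1.eventually (gt_mem_nhds (by positivity : 0 < δ / 3))).and
    (Metric.tendsto_nhds.1 h2 (δ / 3) (by positivity))).exists
  have h3 := Metric.tendsto_nhds.1 (hε.tendsto_integral_polyline hb hW m hF hC) (δ / 3)
    (by positivity)
  obtain ⟨n₀, hn₀⟩ := eventually_atTop.1 (h3.and (eventually_ge_atTop m))
  refine ⟨n₀, fun n hn => ?_⟩
  obtain ⟨h4, hmn⟩ := hn₀ n hn
  have h5 := hbound m n hmn
  rw [← Real.dist_eq] at h5
  have t1 := dist_triangle4 (∫ ω, F (polyline (b ^ n) fun w =>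
      cascadeIncr ε (sigmaHalf b * Real.sqrt n)⁻¹ n 0 w ω) ∂P) (∫ ω, F (polyline (b ^ m) fun w =>
        cascadeIncr ε (sigmaHalf b * Real.sqrt n)⁻¹ m (n - m) w ω) ∂P)
      (∫ f, F (polyline (b ^ m) (gridIncr (b ^ m) f)) ∂(W : Measure C(I, ℝ)))
      (∫ f, F f ∂(W : Measure C(I, ℝ)))
  linarith

end

noncomputable section

open scoped NNReal

/-! ### Gaussian fields -/

/-- The value at `1` of the characteristic function is a `1`-Lipschitz function of the random
variable in `L²`. -/
theorem continuous_integral_cexp_Lp {Ω : Type*} [MeasurableSpace Ω] (P : Measure Ω)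
    [IsProbabilityMeasure P] :
    Continuous fun f : Lp ℝ 2 P => ∫ ω, Complex.exp ((f ω : ℝ) * Complex.I) ∂P := by
  refine (LipschitzWith.of_dist_le_mul (K := 1) fun f g => ?_).continuous
  have hint : ∀ f : Lp ℝ 2 P, Integrable (fun ω => Complex.exp ((f ω : ℝ) * Complex.I)) P := by
    intro f
    refine Integrable.of_bound (C := 1) ?_ (ae_of_all _ fun ω => ?_)
    · exact (Complex.continuous_exp.measurable.comp
        ((Complex.measurable_ofReal.comp (Lp.stronglyMeasurable f).measurable).mul_const
          _)).aestronglyMeasurable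
    · rw [Complex.norm_exp_ofReal_mul_I]
  have hpt : ∀ x y : ℝ, ‖Complex.exp (x * Complex.I) - Complex.exp (y * Complex.I)‖ ≤ ‖x - y‖ := by
    intro x y
    have e : Complex.exp (x * Complex.I) - Complex.exp (y * Complex.I)
        = Complex.exp (y * Complex.I) * (Complex.exp (Complex.I * ((x - y : ℝ) : ℂ)) - 1) := by
      rw [mul_sub, ← Complex.exp_add, mul_one]
      congr 2
      push_cast
      ring
    rw [e, norm_mul, Complex.norm_exp_ofReal_mul_I, one_mul]
    exact Real.norm_exp_I_mul_ofReal_sub_one_le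
  have hL1 : Integrable (fun ω => (f - g) ω) P := (Lp.memLp (f - g)).integrable one_le_two
  rw [NNReal.coe_one, one_mul, dist_eq_norm, dist_eq_norm, ← integral_sub (hint f) (hint g)]
  calc _ ≤ ∫ ω, ‖(f - g) ω‖ ∂P := by
        refine norm_integral_le_of_norm_le hL1.norm ?_
        filter_upwards [Lp.coeFn_sub f g] with ω hω
        rw [hω]
        exact hpt _ _
    _ ≤ ‖f - g‖ := by
        rw [integral_norm_eq_lintegral_enorm (Lp.aestronglyMeasurable _), Lp.norm_def,
          ← eLpNorm_one_eq_lintegral_enorm]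
        exact ENNReal.toReal_mono (Lp.eLpNorm_ne_top _)
          (eLpNorm_le_eLpNorm_of_exponent_le one_le_two (Lp.aestronglyMeasurable _))

/-- Every Hilbert space carries an isonormal Gaussian process: a linear isometry into some `L²`
space all of whose values are centred Gaussian variables. -/
theorem exists_linearIsometry_gaussian (H : Type) [NormedAddCommGroup H] [InnerProductSpace ℝ H]
    [CompleteSpace H] :
    ∃ (Ω : Type) (_ : MeasurableSpace Ω) (P : Measure Ω) (_ : IsProbabilityMeasure P)
      (U : H →ₗᵢ[ℝ] Lp ℝ 2 P), ∀ h, HasLaw (U h) (gaussianReal 0 (‖h‖₊ ^ 2)) P := by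
  classical
  obtain ⟨w, bas, -⟩ := exists_hilbertBasis ℝ H
  obtain ⟨Ω, mΩ, P, ξ, hmeas, hlaw, hind, hP⟩ := exists_iid w (gaussianReal 0 1)
  have hL2 : ∀ i, MemLp (ξ i) 2 P := fun i => (hlaw i).hasGaussianLaw.memLp_two
  set e : w → Lp ℝ 2 P := fun i => (hL2 i).toLp (ξ i) with he
  have hmean : ∀ i, ∫ ω, ξ i ω ∂P = 0 := fun i => by
    rw [(hlaw i).integral_eq, integral_id_gaussianReal]
  have hon : Orthonormal ℝ e := by
    rw [orthonormal_iff_ite]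
    intro i j
    have h1 : inner ℝ (e i) (e j) = ∫ ω, ξ i ω * ξ j ω ∂P := by
      rw [L2.inner_def]
      refine integral_congr_ae ?_
      filter_upwards [(hL2 i).coeFn_toLp, (hL2 j).coeFn_toLp] with ω h1 h2
      simp only [he, h1, h2]
      rw [real_inner_comm]
      rfl
    rw [h1]
    split_ifs with h
    · subst h
      have hv := variance_eq_sub (hL2 i)
      rw [(hlaw i).variance_eq, variance_id_gaussianReal, hmean] at hv
      simp only [Pi.pow_apply] at hv
      simp only [← pow_two]
      simp at hv
      exact hv.symm
    · rw [(hind.indepFun h).integral_fun_mul_eq_mul_integral (hmeas i).aestronglyMeasurable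
        (hmeas j).aestronglyMeasurable, hmean, zero_mul]
  set U : H →ₗᵢ[ℝ] Lp ℝ 2 P :=
    hon.orthogonalFamily.linearIsometry.comp bas.repr.toLinearIsometry with hU
  have hUb : ∀ i, U (bas i) = e i := by
    intro i
    change hon.orthogonalFamily.linearIsometry (bas.repr (bas i)) = e i
    rw [HilbertBasis.repr_self, OrthogonalFamily.linearIsometry_apply_single]
    simp
  -- the finite linear combinations of the basis; the general case follows by continuity
  have hfin : ∀ (s : Finset w) (a : w → ℝ),
      ∫ ω, Complex.exp ((U (∑ i ∈ s, a i • bas i) ω : ℝ) * Complex.I) ∂P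
        = Complex.exp (-(‖∑ i ∈ s, a i • bas i‖ ^ 2 / 2 : ℝ)) := by
    intro s a
    have h1 : ∀ᵐ ω ∂P, U (∑ i ∈ s, a i • bas i) ω = ∑ i ∈ s, a i * ξ i ω := by
      rw [map_sum]
      have h2 : ∀ᵐ ω ∂P, ∀ i ∈ s, U (a i • bas i) ω = a i * ξ i ω := by
        refine (s.eventually_all).2 fun i _ => ?_
        rw [map_smul, hUb]
        filter_upwards [Lp.coeFn_smul (a i) (e i), (hL2 i).coeFn_toLp] with ω h3 h4
        rw [h3, Pi.smul_apply, smul_eq_mul, h4]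
      filter_upwards [h2, Lp.coeFn_fun_finsetSum s fun i => U (a i • bas i)] with ω h3 h4
      rw [h4]
      exact Finset.sum_congr rfl h3
    have hc : ∀ i, HasLaw (fun ω => a i * ξ i ω) (gaussianReal 0 (‖a i‖₊ ^ 2)) P := by
      intro i
      have h := gaussianReal_const_mul (hlaw i) (a i)
      convert h using 2
      · simp
      · ext; simp
    have hind' : iIndepFun (fun i ω => a i * ξ i ω) P :=
      hind.comp (fun i x => a i * x) fun i => measurable_const_mul _
    have hinds : iIndepFun (s.restrict fun i ω => a i * ξ i ω) P :=
      hind'.precomp (g := ((↑) : s → w)) Subtype.val_injective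
    have h5 := congrFun (iIndepFun.charFun_map_fun_finsetSum_eq_prod (s := s)
      (fun i _ => (hc i).aemeasurable) hinds) 1
    rw [Finset.prod_apply, charFun_apply_real, integral_map (by fun_prop) (by fun_prop)] at h5
    rw [integral_congr_ae (h1.mono fun ω hω => by rw [hω])]
    simp only [Complex.ofReal_one, one_mul] at h5
    rw [h5]
    have h6 : ‖∑ i ∈ s, a i • bas i‖ ^ 2 = ∑ i ∈ s, a i ^ 2 := by
      rw [← real_inner_self_eq_norm_sq, bas.orthonormal.inner_sum]
      simp [pow_two]
    rw [h6, Finset.prod_congr rfl fun i _ => by rw [(hc i).map_eq, charFun_gaussianReal],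
      ← Complex.exp_sum]
    congr 1
    push_cast
    simp [Finset.sum_div, Finset.sum_neg_distrib]
    refine Finset.sum_congr rfl fun i _ => ?_
    norm_cast
    simp
  have hall : ∀ h, ∫ ω, Complex.exp ((U h ω : ℝ) * Complex.I) ∂P
      = Complex.exp (-(‖h‖ ^ 2 / 2 : ℝ)) := by
    intro h
    have hs : Tendsto (fun s : Finset w => ∑ i ∈ s, bas.repr h i • bas i) atTop (𝓝 h) :=
      bas.hasSum_repr h
    have c1 := (((continuous_integral_cexp_Lp P).comp U.continuous).tendsto h).comp hs
    have c2 := ((show Continuous fun h : H => Complex.exp (-(‖h‖ ^ 2 / 2 : ℝ)) by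
      fun_prop).tendsto h).comp hs
    refine tendsto_nhds_unique c1 (c2.congr fun s => ?_)
    exact (hfin s _).symm
  refine ⟨Ω, mΩ, P, hP, U, fun h => ⟨(Lp.stronglyMeasurable _).measurable.aemeasurable, ?_⟩⟩
  have hm : AEMeasurable (U h) P := (Lp.stronglyMeasurable _).measurable.aemeasurable
  have := Measure.isProbabilityMeasure_map hm
  refine Measure.ext_of_charFun (funext fun t => ?_)
  rw [charFun_gaussianReal, charFun_apply_real, integral_map hm (by fun_prop)]
  have h7 := hall (t • h)
  rw [map_smul] at h7
  have h8 : ∀ᵐ ω ∂P, (t • U h : Lp ℝ 2 P) ω = t * U h ω := Lp.coeFn_smul t (U h)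
  rw [integral_congr_ae (h8.mono fun ω hω => by rw [hω])] at h7
  push_cast at h7
  rw [h7, norm_smul]
  congr 1
  push_cast
  have h9 : ((|t| : ℝ) : ℂ) ^ 2 = (t : ℂ) ^ 2 := by norm_cast; simp
  simp only [Real.norm_eq_abs]
  rw [mul_pow, h9]
  ring

end

noncomputable section

open scoped NNReal

/-! ### Brownian motion -/

/-- Brownian motion without continuity of paths: the values of an isonormal Gaussian process on
`L²(ℝ)` at the indicators of the intervals `(0, t]`. -/
theorem exists_isPreBrownianReal :
    ∃ (Ω : Type) (_ : MeasurableSpace Ω) (P : Measure Ω) (B : ℝ≥0 → Ω → ℝ),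
      (∀ t, Measurable (B t)) ∧ IsPreBrownianReal B P := by
  obtain ⟨Ω, mΩ, P, hP, U, hU⟩ := exists_linearIsometry_gaussian (Lp ℝ 2 (volume : Measure ℝ))
  have hfin : ∀ t : ℝ≥0, volume (Set.Ioc (0 : ℝ) t) ≠ ⊤ := fun t => measure_Ioc_lt_top.ne
  set g : ℝ≥0 → Lp ℝ 2 (volume : Measure ℝ) := fun t =>
    indicatorConstLp 2 (measurableSet_Ioc (a := (0 : ℝ)) (b := t)) (hfin t) 1 with hg
  set B : ℝ≥0 → Ω → ℝ := fun t => U (g t) with hB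
  have hmeas : ∀ t, Measurable (B t) := fun t => (Lp.stronglyMeasurable _).measurable
  have hmean : ∀ t, ∫ ω, B t ω ∂P = 0 := fun t => by
    rw [(hU (g t)).integral_eq, integral_id_gaussianReal]
  refine ⟨Ω, mΩ, P, B, hmeas, IsGaussianProcess.isPreBrownianReal_of_covariance ⟨fun J => ⟨?_⟩⟩
    hmean fun s t hst => ?_⟩
  · refine isGaussian_of_map_eq_gaussianReal fun L => ?_
    have hR : Measurable fun ω => J.restrict fun t => B t ω :=
      measurable_pi_lambda _ fun i => hmeas i
    rw [Measure.map_map L.continuous.measurable hR]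
    -- a linear combination of the values of the process is its value at a linear combination
    set h : Lp ℝ 2 (volume : Measure ℝ) := ∑ i : J, L (Pi.single i 1) • g i with hh
    refine ⟨0, ‖h‖₊ ^ 2, ?_⟩
    rw [← (hU h).map_eq]
    refine Measure.map_congr ?_
    have h1 : ∀ᵐ ω ∂P, ∀ i : J, U (L (Pi.single i 1) • g i) ω = L (Pi.single i 1) * B i ω := by
      refine ae_all_iff.2 fun i => ?_
      rw [map_smul]
      exact Lp.coeFn_smul _ _
    have h2 := Lp.coeFn_fun_finsetSum Finset.univ fun i : J => U (L (Pi.single i 1) • g i)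
    rw [hh, map_sum]
    filter_upwards [h1, h2] with ω h3 h4
    rw [h4, Function.comp_apply]
    refine (L.toLinearMap.pi_apply_eq_sum_univ _).trans (Finset.sum_congr rfl fun i _ => ?_)
    have hsingle : (fun j : J => if i = j then (1 : ℝ) else 0) = Pi.single i 1 := by
      ext j
      simp [Pi.single_apply, eq_comm]
    rw [h3 i, smul_eq_mul, mul_comm, hsingle]
    rfl
  · rw [covariance_eq_sub (Lp.memLp _) (Lp.memLp _), hmean, zero_mul, sub_zero]
    have h1 : inner ℝ (U (g s)) (U (g t)) = (s : ℝ) := by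
      rw [U.inner_map_map, hg, L2.real_inner_indicatorConstLp_one_indicatorConstLp_one
        _ _ (hfin s) (hfin t), Set.Ioc_inter_Ioc]
      simp [hst]
    rw [← h1, L2.inner_def]
    refine integral_congr_ae (ae_of_all _ fun ω => ?_)
    exact mul_comm _ _

/-- The increment of Brownian motion over an interval of length at most `v` has fourth moment at
most `48 e v ^ 2`. -/
theorem ProbabilityTheory.IsPreBrownianReal.integral_sub_pow_four_le {Ω : Type*} [MeasurableSpace Ω]
    {P : Measure Ω} {B : ℝ≥0 → Ω → ℝ} (hB : IsPreBrownianReal B P) {s t : ℝ≥0} {v : ℝ} (hv : 0 < v)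
    (hst : |(s : ℝ) - t| ≤ v) :
    Integrable (fun ω => (B s ω - B t ω) ^ 4) P ∧
      ∫ ω, (B s ω - B t ω) ^ 4 ∂P ≤ 48 * Real.exp 1 * v ^ 2 := by
  have hlaw := hB.hasLaw_sub s t
  have hvar : ((nndist s.1 t.1 : ℝ≥0) : ℝ) ≤ v := by rw [coe_nndist, Real.dist_eq]; exact hst
  set γ := gaussianReal 0 (nndist s.1 t.1)
  have hI : Integrable (fun x : ℝ => x ^ 4) γ := by
    have := (memLp_id_gaussianReal (μ := 0) (v := nndist s.1 t.1) 4).integrable_norm_pow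
      (by norm_num)
    refine this.congr (ae_of_all _ fun x => ?_)
    change |x| ^ 4 = x ^ 4
    rw [← abs_pow, abs_of_nonneg (by positivity)]
  have hI' : Integrable ((fun x : ℝ => x ^ 4) ∘ (B s - B t)) P := by
    rw [← hlaw.map_eq] at hI
    exact hI.comp_aemeasurable hlaw.aemeasurable
  refine ⟨hI', ?_⟩
  have he := hlaw.integral_comp (f := fun x : ℝ => x ^ 4) (by fun_prop)
  have he' : ∫ ω, (B s ω - B t ω) ^ 4 ∂P = ∫ x, x ^ 4 ∂γ := he
  rw [he']
  -- `x ^ 4 ≤ 24 v ^ 2 (exp (x / √v) + exp (-x / √v))`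
  set c := (Real.sqrt v)⁻¹ with hc
  have hc2 : c ^ 2 = v⁻¹ := by rw [hc, inv_pow, Real.sq_sqrt hv.le]
  have hpt : ∀ x : ℝ, x ^ 4 ≤ v ^ 2 * (24 * (Real.exp (c * x) + Real.exp (-c * x))) := by
    intro x
    have h := pow_four_le_exp_add_exp (c * x)
    have e : (c * x) ^ 4 = (v ^ 2)⁻¹ * x ^ 4 := by
      rw [mul_pow, show c ^ 4 = (c ^ 2) ^ 2 by ring, hc2, inv_pow]
    rw [e, inv_mul_le_iff₀ (by positivity)] at h
    rwa [neg_mul]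
  have hm : ∀ a : ℝ, a ^ 2 = v⁻¹ → ∫ x, Real.exp (a * x) ∂γ ≤ Real.exp 1 := by
    intro a ha
    have h := congrFun (mgf_fun_id_gaussianReal (μ := 0) (v := nndist s.1 t.1)) a
    rw [mgf] at h
    rw [h, ha, Real.exp_le_exp, zero_mul, zero_add, ← div_eq_mul_inv]
    have := (div_le_one hv).2 hvar
    linarith
  have i1 := integrable_exp_mul_gaussianReal (μ := 0) (v := nndist s.1 t.1) c
  have i2 := integrable_exp_mul_gaussianReal (μ := 0) (v := nndist s.1 t.1) (-c)
  refine (integral_mono hI (((i1.add i2).const_mul 24).const_mul (v ^ 2)) hpt).trans ?_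
  simp only [Pi.add_apply]
  rw [integral_const_mul, integral_const_mul, integral_add i1 i2]
  nlinarith [sq_nonneg v, hm c hc2, hm (-c) (by rw [neg_sq, hc2])]

/-- The first absolute moment in the form suited to `chainRate`, whose powers are fourth roots of
interval lengths. -/
theorem ProbabilityTheory.IsPreBrownianReal.integral_abs_sub_le {Ω : Type*} [MeasurableSpace Ω]
    {P : Measure Ω} {B : ℝ≥0 → Ω → ℝ} (hB : IsPreBrownianReal B P) {s t : ℝ≥0} {l : ℝ}
    (hl : 0 < l) (hl1 : l ≤ 1)
    (hst : |(s : ℝ) - t| ≤ l ^ 4) :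
    Integrable (fun ω => |B s ω - B t ω|) P ∧
      ∫ ω, |B s ω - B t ω| ∂P ≤ (1 + 48 * Real.exp 1) * l := by
  have := hB.isGaussianProcess.isProbabilityMeasure
  have hI : Integrable (fun ω => |B s ω - B t ω|) P :=
    ((hB.integrable_eval s).sub (hB.integrable_eval t)).abs
  obtain ⟨h4, h4'⟩ := hB.integral_sub_pow_four_le (by positivity) hst
  refine ⟨hI, ?_⟩
  have hpt : ∀ ω, |B s ω - B t ω| ≤ l + (l ^ 3)⁻¹ * (B s ω - B t ω) ^ 4 :=
    fun ω => abs_le_add_pow_four hl _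
  refine (integral_mono hI ((integrable_const _).add (h4.const_mul _)) hpt).trans ?_
  simp only [Pi.add_apply]
  rw [integral_add (integrable_const _) (h4.const_mul _), integral_const_mul]
  simp only [integral_const, probReal_univ, one_smul]
  have h5 := mul_le_mul_of_nonneg_left h4' (by positivity : 0 ≤ (l ^ 3)⁻¹)
  have h6 : (l ^ 3)⁻¹ * (48 * Real.exp 1 * (l ^ 4) ^ 2) = 48 * Real.exp 1 * l * l ^ 4 := by
    field_simp
  have h7 : l ^ 4 ≤ 1 := pow_le_one₀ hl.le hl1
  have h8 : 48 * Real.exp 1 * l * l ^ 4 ≤ 48 * Real.exp 1 * l * 1 := by gcongr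
  linarith

/-- A random series whose terms have geometrically small expectations converges almost surely. -/
theorem ae_summable_of_integral_le_geometric {Ω : Type*} [MeasurableSpace Ω] {P : Measure Ω}
    {f : ℕ → Ω → ℝ} {C q : ℝ} (hq0 : 0 ≤ q) (hq1 : q < 1) (hf0 : ∀ r ω, 0 ≤ f r ω)
    (hf : ∀ r, Integrable (f r) P ∧ ∫ ω, f r ω ∂P ≤ C * q ^ r) :
    ∀ᵐ ω ∂P, Summable fun r => f r ω := by
  have hm : ∀ r, AEMeasurable (fun ω => ENNReal.ofReal (f r ω)) P := fun r =>
    (hf r).1.aemeasurable.ennreal_ofReal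
  have hlt : ∫⁻ ω, ∑' r, ENNReal.ofReal (f r ω) ∂P ≠ ⊤ := by
    rw [lintegral_tsum hm]
    have hs : Summable fun r => ∫ ω, f r ω ∂P :=
      Summable.of_nonneg_of_le (fun r => integral_nonneg (hf0 r)) (fun r => (hf r).2)
        ((summable_geometric_of_lt_one hq0 hq1).mul_left C)
    have e : ∀ r, ∫⁻ ω, ENNReal.ofReal (f r ω) ∂P = ENNReal.ofReal (∫ ω, f r ω ∂P) := fun r =>
      (ofReal_integral_eq_lintegral_ofReal (hf r).1 (ae_of_all _ (hf0 r))).symm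
    simp only [e]
    exact hs.tsum_ofReal_ne_top
  filter_upwards [ae_lt_top' (AEMeasurable.tsum hm) hlt] with ω hω
  have := ENNReal.summable_toReal hω.ne
  simpa only [ENNReal.toReal_ofReal (hf0 _ ω)] using this

/-- A Brownian motion restricted to `[0,1]` has a modification with continuous paths: the almost
sure uniform limit of its interpolations on the dyadic grids. -/
theorem ProbabilityTheory.IsPreBrownianReal.exists_continuous_modification {Ω : Type*}
    [MeasurableSpace Ω] {P : Measure Ω} {B : ℝ≥0 → Ω → ℝ} (hB : IsPreBrownianReal B P)
    (hm : ∀ t, Measurable (B t)) :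
    ∃ Z : Ω → C(I, ℝ), Measurable Z ∧ ∀ t : I, ∀ᵐ ω ∂P, Z ω t = B ⟨t, t.2.1⟩ ω := by
  have hP := hB.isGaussianProcess.isProbabilityMeasure
  set G : ℕ → ℕ → ℝ≥0 := fun r k => (k : ℝ≥0) / 2 ^ r with hG
  set X : ℕ → Ω → C(I, ℝ) := fun r ω =>
    polyline (2 ^ r) fun k => B (G r (k + 1)) ω - B (G r k) ω with hX
  have hq0 := chainRate_pos 2
  have hq1 := chainRate_lt_one (le_refl 2)
  have hq4 : ∀ r, (chainRate 2 ^ r) ^ 4 = ((2 : ℝ) ^ r)⁻¹ := fun r => by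
    rw [← pow_mul, mul_comm, pow_mul, chainRate_pow_four, inv_pow, Nat.cast_ofNat]
  have hGG : ∀ r k, |(G r (k + 1) : ℝ) - G r k| = ((2 : ℝ) ^ r)⁻¹ := by
    intro r k
    simp only [hG]
    push_cast
    rw [← sub_div, add_sub_cancel_left, one_div, abs_of_nonneg (by positivity)]
  have hstep : ∀ r, Integrable (fun ω => ‖X (r + 1) ω - X r ω‖) P ∧
      ∫ ω, ‖X (r + 1) ω - X r ω‖ ∂P
        ≤ ((2 : ℕ) * (1 + 48 * Real.exp 1) * chainRate 2) * chainRate 2 ^ r := by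
    intro r
    have h := integral_norm_polyline_sub_polyline_blockSum_le (P := P) (b := 2)
      (K := 48 * Real.exp 1) r (d := fun k ω => B (G (r + 1) (k + 1)) ω - B (G (r + 1) k) ω)
      (fun k => (hm _).sub (hm _))
      (fun k _ => (hB.integral_sub_pow_four_le (by positivity) (hGG _ _).le).1)
      (fun k _ => ?_)
    · have e : ∀ ω, X r ω = polyline (2 ^ r)
          (blockSum 2 fun k => B (G (r + 1) (k + 1)) ω - B (G (r + 1) k) ω) := by
        intro ω
        simp only [hX]
        congr 1
        funext k
        have e2 : ∀ k, G (r + 1) (k * 2) = G r k := fun k => by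
          simp only [hG]
          push_cast
          rw [pow_succ, mul_div_mul_right _ _ two_ne_zero]
        simp only [blockSum, Finset.sum_range_succ, Finset.sum_range_zero, zero_add, add_zero]
        rw [show k * 2 + 1 + 1 = (k + 1) * 2 by ring, e2, e2]
        ring
      simp only [e]
      refine ⟨h.1, h.2.trans (le_of_eq ?_)⟩
      rw [pow_succ]
      ring
    · have h2 := (hB.integral_sub_pow_four_le (by positivity) (hGG (r + 1) k).le).2
      rwa [inv_pow] at h2
  have hconv : ∀ᵐ ω ∂P, ∃ z, Tendsto (fun r => X r ω) atTop (𝓝 z) := by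
    filter_upwards [ae_summable_of_integral_le_geometric hq0.le hq1
      (fun r ω => norm_nonneg (X (r + 1) ω - X r ω)) hstep] with ω hω
    refine cauchySeq_tendsto_of_complete (cauchySeq_of_summable_dist (hω.congr fun r => ?_))
    rw [dist_comm, dist_eq_norm]
  have hXm : ∀ r, Measurable (X r) := fun r => measurable_polyline _ fun k => (hm _).sub (hm _)
  obtain ⟨Z, hZm, hZ⟩ := measurable_limit_of_tendsto_metrizable_ae
    (fun r => (hXm r).aemeasurable) hconv
  refine ⟨Z, hZm, fun t => ?_⟩
  set T : ℝ≥0 := ⟨t, t.2.1⟩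
  have hN : ∀ r, 0 < 2 ^ r := fun r => by positivity
  choose k hk h1 h2 using fun r => exists_cell (hN r) t
  push_cast at h1 h2
  have hclose : ∀ r, |(G r (k r) : ℝ) - T| ≤ (chainRate 2 ^ r) ^ 4 ∧
      |(G r (k r + 1) : ℝ) - T| ≤ (chainRate 2 ^ r) ^ 4 := by
    intro r
    have h2r : (0 : ℝ) < 2 ^ r := by positivity
    have e1 : (G r (k r) : ℝ) = k r / 2 ^ r := by simp [hG]
    have e2 : (G r (k r + 1) : ℝ) = (k r + 1) / 2 ^ r := by simp [hG]
    have e3 : ((T : ℝ≥0) : ℝ) = t := rfl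
    have e4 : (t : ℝ) = 2 ^ r * t / 2 ^ r := by field_simp
    rw [hq4, e1, e2, e3, e4, ← sub_div, ← sub_div, abs_div, abs_div, abs_of_pos h2r, ← one_div]
    constructor <;> gcongr <;> rw [abs_le] <;> constructor <;> linarith [h1 r, h2 r]
  -- at a fixed time the interpolations converge almost surely to the original process
  have hsum := ae_summable_of_integral_le_geometric (P := P) hq0.le hq1
    (C := 2 * (1 + 48 * Real.exp 1))
    (f := fun r ω => |B (G r (k r)) ω - B T ω| + |B (G r (k r + 1)) ω - B T ω|)
    (fun r ω => by positivity) (fun r => by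
      have hl0 := pow_pos hq0 r
      have hl1 := pow_le_one₀ hq0.le hq1.le (n := r)
      obtain ⟨i1, b1⟩ := hB.integral_abs_sub_le hl0 hl1 (hclose r).1
      obtain ⟨i2, b2⟩ := hB.integral_abs_sub_le hl0 hl1 (hclose r).2
      refine ⟨i1.add i2, ?_⟩
      rw [integral_add i1 i2]
      linarith)
  filter_upwards [hsum, hZ, hB.eval_zero_ae_eq_zero] with ω hs hz h0
  have c1 : Tendsto (fun r => X r ω t) atTop (𝓝 (Z ω t)) :=
    ((continuous_eval_const t).tendsto _).comp hz
  refine tendsto_nhds_unique c1 (tendsto_iff_norm_sub_tendsto_zero.2 ?_)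
  refine squeeze_zero (fun _ => norm_nonneg _) (fun r => ?_) hs.tendsto_atTop_zero
  have hX' := polyline_increments_apply (fun i => B (G r i) ω) (hk r)
    (by push_cast; exact h1 r) (by push_cast; exact h2 r)
  have hG0 : G r 0 = 0 := by simp [hG]
  simp only [hG0, h0, sub_zero] at hX'
  push_cast at hX'
  simp only [hX]
  rw [hX']
  set θ := (2 : ℝ) ^ r * (t : ℝ) - k r with hθ
  have hθ0 : 0 ≤ θ := by linarith [h1 r]
  have hθ1 : θ ≤ 1 := by linarith [h2 r]
  rw [show (1 - θ) * B (G r (k r)) ω + θ * B (G r (k r + 1)) ω - B T ω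
    = (1 - θ) * (B (G r (k r)) ω - B T ω) + θ * (B (G r (k r + 1)) ω - B T ω) by ring]
  refine (norm_add_le _ _).trans ?_
  rw [Real.norm_eq_abs, Real.norm_eq_abs, abs_mul, abs_mul, abs_of_nonneg hθ0,
    abs_of_nonneg (by linarith : 0 ≤ 1 - θ)]
  exact add_le_add (mul_le_of_le_one_left (abs_nonneg _) (by linarith))
    (mul_le_of_le_one_left (abs_nonneg _) hθ1)

/-- Existence of Wiener measure, as the law of the continuous modification of Brownian motion. -/
theorem exists_isWienerMeasure :
    ∃ W : ProbabilityMeasure C(I, ℝ), IsWienerMeasure (W : Measure C(I, ℝ)) := by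
  obtain ⟨Ω, mΩ, P, B, hm, hB⟩ := exists_isPreBrownianReal
  have hP := hB.isGaussianProcess.isProbabilityMeasure
  obtain ⟨Z, hZm, hZ⟩ := hB.exists_continuous_modification hm
  have hev : ∀ t : I, Measurable fun f : C(I, ℝ) => f t := fun t =>
    (continuous_eval_const t).measurable
  refine ⟨⟨P.map Z, Measure.isProbabilityMeasure_map hZm.aemeasurable⟩, ?_, ?_, ?_⟩
  · change ∀ᵐ f ∂(P.map Z), f 0 = 0
    rw [ae_map_iff hZm.aemeasurable (measurableSet_eq_fun (hev 0) measurable_const)]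
    filter_upwards [hZ 0, hB.eval_zero_ae_eq_zero] with ω h1 h2
    rw [h1]
    exact h2
  · intro n t ht
    change iIndepFun _ (P.map Z)
    have h := hB.hasIndepIncrements n (fun i => ⟨t i, (t i).2.1⟩) fun i j hij => ht hij
    have h' := h.congr (g := fun i ω => Z ω (t i.succ) - Z ω (t i.castSucc)) fun i => by
      filter_upwards [hZ (t i.succ), hZ (t i.castSucc)] with ω h1 h2
      rw [h1, h2]
    have hincr : ∀ i : Fin n, Measurable fun f : C(I, ℝ) => f (t i.succ) - f (t i.castSucc) :=
      fun i => (hev _).sub (hev _)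
    have hpath : Measurable fun (f : C(I, ℝ)) (i : Fin n) => f (t i.succ) - f (t i.castSucc) :=
      measurable_pi_lambda _ hincr
    have := Measure.isProbabilityMeasure_map (μ := P) hZm.aemeasurable
    have h' := (iIndepFun_iff_map_fun_eq_pi_map fun i =>
      ((hincr i).comp hZm).aemeasurable).1 h'
    rw [iIndepFun_iff_map_fun_eq_pi_map fun i => (hincr i).aemeasurable,
      Measure.map_map hpath hZm]
    refine Eq.trans h' ?_
    congr 1
    funext i
    rw [Measure.map_map (hincr i) hZm]
  · intro s t hst
    change HasLaw _ _ (P.map Z)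
    refine ⟨((hev t).sub (hev s)).aemeasurable, ?_⟩
    have hts : Measurable fun f : C(I, ℝ) => f t - f s := (hev t).sub (hev s)
    rw [Measure.map_map hts hZm]
    have h := (hB.hasLaw_sub ⟨t, t.2.1⟩ ⟨s, s.2.1⟩).map_eq
    have e : nndist (t : ℝ) (s : ℝ) = Real.toNNReal ((t : ℝ) - s) := by
      have hst' : (s : ℝ) ≤ t := hst
      ext
      rw [coe_nndist, Real.dist_eq, abs_of_nonneg (by linarith), Real.coe_toNNReal _ (by linarith)]
    rw [← e]
    refine Eq.trans (Measure.map_congr ?_) h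
    filter_upwards [hZ t, hZ s] with ω h1 h2
    simp only [Function.comp_apply, Pi.sub_apply]
    rw [h1, h2]

end

/-! ### From almost sure signs to signs -/

/-- Weights with law `signLaw b (1 / 2)` are almost surely signs; changing them on a null set makes
them signs everywhere. -/
theorem exists_isSignCascade_ae_eq {b : ℕ} {Ω : Type*} [MeasurableSpace Ω] {P : Measure Ω}
    {ε : List (Fin b) → Ω → ℝ} (hm : ∀ w, Measurable (ε w))
    (hlaw : ∀ w, P.map (ε w) = signLaw b (1 / 2)) (hind : iIndepFun ε P) :
    ∃ ε' : List (Fin b) → Ω → ℝ, IsSignCascade ε' P ∧ ∀ᵐ ω ∂P, ∀ w, ε' w ω = ε w ω := by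
  classical
  set φ : ℝ → ℝ := fun x => if x = 1 then 1 else -1 with hφ
  have hφm : Measurable φ := Measurable.ite (measurableSet_singleton 1) measurable_const
    measurable_const
  have hae : ∀ w, ∀ᵐ ω ∂P, φ (ε w ω) = ε w ω := by
    intro w
    have h : ∀ᵐ x ∂(P.map (ε w)), φ x = x := by
      rw [hlaw, signLaw, ae_add_measure_iff]
      constructor <;> refine Measure.ae_smul_measure ?_ _ <;>
        rw [ae_dirac_iff (measurableSet_eq_fun hφm measurable_id')] <;> norm_num [hφ]
    exact ae_of_ae_map (hm w).aemeasurable h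
  refine ⟨fun w ω => φ (ε w ω), ⟨fun w => hφm.comp (hm w), fun w => ?_,
    hind.comp (fun _ => φ) fun _ => hφm, fun w ω => ?_⟩, ae_all_iff.2 hae⟩
  · rw [← hlaw w]
    exact Measure.map_congr (hae w)
  · simp only [hφ]
    split_ifs
    · exact Or.inl rfl
    · exact Or.inr rfl

theorem theorem2 :
    ∃ W : ProbabilityMeasure C(I, ℝ), IsWienerMeasure (W : Measure C(I, ℝ)) ∧
      ∀ (b : ℕ) [NeZero b], 2 ≤ b →
      ∀ (Ω : Type*) [MeasurableSpace Ω] (P : Measure Ω) [IsProbabilityMeasure P]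
        (ε : List (Fin b) → Ω → ℝ),
        (∀ w, Measurable (ε w)) →
        (∀ w, P.map (ε w) = signLaw b (1 / 2)) →
        iIndepFun ε P →
        TendstoInDistribution
          (fun (n : ℕ) (ω : Ω) =>
            (sigmaHalf b * Real.sqrt n)⁻¹ • cascadePath b (1 / 2) (fun w => ε w ω) n)
          atTop (id : C(I, ℝ) → C(I, ℝ)) (fun _ => P) (W : Measure C(I, ℝ)) := by
  obtain ⟨W, hW⟩ := exists_isWienerMeasure
  refine ⟨W, hW, fun b _ hb Ω _ P _ ε hm hlaw hind => ?_⟩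
  obtain ⟨ε', hε', hae⟩ := exists_isSignCascade_ae_eq hm hlaw hind
  refine (hε'.tendstoInDistribution hb W hW).congr (fun n => ?_) (ae_eq_refl _)
  filter_upwards [hae] with ω hω
  simp only [hω]
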